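/- For a function $f$ on the imaginary segment $\mathrm{i}[-1,1]$ put $\|f\|=\max_{x\in[-1,1]}|f(\mathrm{i}x)|$. An $(n,n)$-rational function is a quotient $p/q$ of complex polynomials of degree at most $n$, $q\neq0$ (common zeros being cancelled); it is unitary if $|r(\mathrm{i}x)|=1$ for all $x\in\mathbb{R}$. Let $n\ge 0$ be an integer, let $\omega\in(0,(n+1)\pi)$, and let $\widetilde r$ be the unitary best approximant, i.e. a unitary $(n,n)$-rational function that minimizes $\|s-\exp(\omega\,\cdot)\|$ over all unitary $(n,n)$-rational functions $s$. Consider an $(n,n)$-rational function $r$ together with nodes $-1<x_1<\dots<x_{2n+1}<1$ and points $\eta_1,\dots,\eta_{2n+2}$ such that 1. $r(\mathrm{i}x_j)=\mathrm{e}^{\mathrm{i}\omega x_j}$ for $j=1,\dots,2n+1$; 2. $-1\le\eta_1<x_1<\eta_2<\dots<x_{2n+1}<\eta_{2n+2}\le1$, and the error $|r(\mathrm{i}x)-\mathrm{e}^{\mathrm{i}\omega x}|$ attains its maximum over $[-1,x_1)$ at $\eta_1$, its maximum over $(x_{j-1},x_j)$ at $\eta_j$ for $j=2,\dots,2n+1$,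 and its maximum over $(x_{2n+1},1]$ at $\eta_{2n+2}$; 3. $\|r-\exp(\omega\,\cdot)\|<2$; 4. the phase error alternates in sign at the points $\eta_j$: for the phase function $g:\mathbb{R}\to\mathbb{R}$ with $r(\mathrm{i}x)=\mathrm{e}^{\mathrm{i}g(x)}$ for $x\in\mathbb{R}$ and $|g(x)-\omega x|<\pi$ for $x\in[-1,1]$ (its values on $[-1,1]$ are determined by this), there is $\iota\in\{0,1\}$ with $g(\eta_j)-\omega\eta_j=(-1)^{j+\iota}|g(\eta_j)-\omega\eta_j|$ for $j=1,\dots,2n+2$. Let $\varepsilon_j=|r(\mathrm{i}\eta_j)-\mathrm{e}^{\mathrm{i}\omega\eta_j}|$, and let the error in uniformity of $r$ be $\delta=1-\min_{j}\varepsilon_j\big/\max_{k}\varepsilon_k$. Then $$(1-\delta)\,\|r-\exp(\omega\,\cdot)\|\le\|\widetilde r-\exp(\omega\,\cdot)\|\le\|r-\exp(\omega\,\cdot)\|,$$ and $$\frac{\bigl|\,\|r-\exp(\omega\,\cdot)\|-\|\widetilde r-\exp(\omega\,\cdot)\|\,\bigr|}{\|r-\exp(\omega\,\cdot)\|}\le\delta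 .$$ Moreover, let $n$ and $\omega$ be fixed and let $(r_k)_{k\in\mathbb{N}}$ be a sequence of $(n,n)$-rational functions, each satisfying conditions 1-4 with its own nodes and points, and let $\delta_k$ be the error in uniformity of $r_k$. If $\delta_k\to0$ as $k\to\infty$, then $\|r_k-\widetilde r\|\to0$. -/

import Mathlib

open Filter Topology

noncomputable section

namespace UnitaryApprox

/-- The value `r(z)` of a rational function, computed from its reduced fraction, so that common
zeros of a numerator and a denominator play no role. At a pole the value is `0` by convention;
in particular `|r(z)| = 1` is impossible at a pole. -/
def val (r : RatFunc ℂ) (z : ℂ) : ℂ := r.eval (RingHom.id ℂ) z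

/-- `r` is an `(n,n)`-rational function: `r = p / q` with polynomials of degree at most `n`. -/
def IsRational (n : ℕ) (r : RatFunc ℂ) : Prop :=
  ∃ p q : Polynomial ℂ, p.natDegree ≤ n ∧ q.natDegree ≤ n ∧ q ≠ 0 ∧
    r = algebraMap (Polynomial ℂ) (RatFunc ℂ) p / algebraMap (Polynomial ℂ) (RatFunc ℂ) q

/-- `r` is unitary: `|r(ix)| = 1` for all real `x`. -/
def IsUnitary (r : RatFunc ℂ) : Prop :=
  ∀ x : ℝ, ‖val r (Complex.I * x)‖ = 1

/-- The class of unitary `(n,n)`-rational functions. -/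
def unitaryClass (n : ℕ) : Set (RatFunc ℂ) :=
  {r | IsRational n r ∧ IsUnitary r}

/-- The uniform norm `max_{x ∈ [-1,1]} |f(ix)|`. -/
def supNorm (f : ℂ → ℂ) : ℝ :=
  sSup ((fun x : ℝ => ‖f (Complex.I * x)‖) '' Set.Icc (-1) 1)

/-- The approximation error `|r(ix) - exp(iωx)|` at the point `x`. -/
def pointError (ω : ℝ) (r : RatFunc ℂ) (x : ℝ) : ℝ :=
  ‖val r (Complex.I * x) - Complex.exp (Complex.I * (ω * x))‖

/-- The uniform error `‖r - exp(ω ·)‖`. -/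
def uniformError (ω : ℝ) (r : RatFunc ℂ) : ℝ :=
  supNorm (fun z => val r z - Complex.exp (ω * z))

/-- `r` minimizes the uniform error among the unitary `(n,n)`-rational functions. -/
def IsUnitaryBestApproximant (n : ℕ) (ω : ℝ) (r : RatFunc ℂ) : Prop :=
  r ∈ unitaryClass n ∧ ∀ s ∈ unitaryClass n, uniformError ω r ≤ uniformError ω s

/-- `g` is a phase function of `r`: `r(ix) = exp(i g(x))` for all real `x`, and the phase error
`g(x) - ωx` lies in `(-π, π)` for `x ∈ [-1,1]`, which determines `g` on `[-1,1]`. -/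
def IsPhaseFunction (ω : ℝ) (r : RatFunc ℂ) (g : ℝ → ℝ) : Prop :=
  (∀ x : ℝ, val r (Complex.I * x) = Complex.exp (Complex.I * (g x))) ∧
    ∀ x ∈ Set.Icc (-1 : ℝ) 1, |g x - ω * x| < Real.pi

/-- The phase error of `r` has an alternating sign at the points `τ 0, τ 1, …`. -/
def PhaseErrorAlternates (ω : ℝ) (r : RatFunc ℂ) {m : ℕ} (τ : Fin m → ℝ) : Prop :=
  ∃ g : ℝ → ℝ, IsPhaseFunction ω r g ∧ ∃ ι : ℕ, (ι = 0 ∨ ι = 1) ∧ ∀ j : Fin m,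
    g (τ j) - ω * τ j = (-1) ^ ((j : ℕ) + 1 + ι) * |g (τ j) - ω * τ j|

/-- The subintervals of `[-1,1]` cut out by the nodes `x 0 < ⋯ < x (m - 1)`: the one with index
`j` is `[-1, x 0)` for `j = 0`, `(x (j - 1), x j)` for `0 < j < m`, and `(x (m - 1), 1]` for
`j = m`. -/
def subinterval {m : ℕ} (x : Fin m → ℝ) (j : ℕ) : Set ℝ :=
  {t | t ∈ Set.Icc (-1 : ℝ) 1 ∧ (∀ i : Fin m, (i : ℕ) < j → x i < t) ∧
    ∀ i : Fin m, j ≤ (i : ℕ) → t < x i}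

/-- `r` is an `(n,n)`-rational interpolant to `exp(iωx)` at the nodes `x` in `(-1,1)`, and `η j`
is a point of maximal approximation error in the `j`-th subinterval cut out by the nodes. -/
structure IsInterpolant (n : ℕ) (ω : ℝ) (r : RatFunc ℂ)
    (x : Fin (2 * n + 1) → ℝ) (η : Fin (2 * n + 2) → ℝ) : Prop where
  rational : IsRational n r
  strictMono : StrictMono x
  mem_Ioo : ∀ i, x i ∈ Set.Ioo (-1 : ℝ) 1
  interpolates : ∀ i, val r (Complex.I * (x i)) = Complex.exp (Complex.I * (ω * x i))
  mem_subinterval : ∀ j : Fin (2 * n + 2), η j ∈ subinterval x (j : ℕ)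
  isMax : ∀ j : Fin (2 * n + 2), ∀ t ∈ subinterval x (j : ℕ), pointError ω r t ≤ pointError ω r (η j)

/-- The error in uniformity `δ = 1 - min_j ε_j / max_k ε_k`, with `ε_j` the error at `η j`. -/
def errorInUniformity (n : ℕ) (ω : ℝ) (r : RatFunc ℂ) (η : Fin (2 * n + 2) → ℝ) : ℝ :=
  1 - (⨅ j, pointError ω r (η j)) / (⨆ k, pointError ω r (η k))

/-- The conditions imposed on an interpolant: the error is not maximal and the phase error
alternates in sign at the points of intermediate maximal error. -/
structure IsAlternatingInterpolant (n : ℕ) (ω : ℝ) (r : RatFunc ℂ)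
    (x : Fin (2 * n + 1) → ℝ) (η : Fin (2 * n + 2) → ℝ) : Prop where
  interpolant : IsInterpolant n ω r x η
  nonmaximal : uniformError ω r < 2
  alternates : PhaseErrorAlternates ω r η

end UnitaryApprox

end

namespace UnitaryApprox

open Polynomial

/-! On the imaginary axis a unitary function equals `conj U / U` with `U` a polynomial in the real
variable of degree at most `n`. If its error stays below 2, it equals `exp (i (ωx + e x))` on [-1,1]
with a differentiable phase error `e` in (-π, π), and the pointwise error is `2 sin (|e| / 2)`. For
two such functions, with data `U, e` and `V, f`, the number `Im (conj U · V)` is a real polynomial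
`D` of degree at most `2n`, and `D = ± |U| |V| sin ((e - f) / 2)` with one sign on all of [-1,1].

Error bounds. If some unitary `q` had error below every `ε_j`, then `|f| < |e|` at all `η j`, so the
sign of `e - f`, hence of `D`, would alternate at `2n + 2` points. This is impossible in degree
`2n`. Thus the best error is at least `min ε_j`, which is at least `(1 - δ)` times the error of `r`;
the upper bound is minimality (`error_bounds`).

Convergence. Let `E` be the best error; the case `E = 0` is immediate. For `δ_k` tending to 0, the
same polynomial `D`, now formed with the best approximant, alternates up to a defect `τ_k` tending
to 0. Such a polynomial is small on [-1,1] provided the `η j` stay apart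
(`abs_eval_le_of_alternating`). Separation, and the division by `|U| |V|`, need the poles of `r_k`
to stay uniformly away from the axis (`exists_pole_bound`).

This bound rests on two facts. The inner points `η j` are critical points of `e`; there are `2n` of
them, so they determine the sign of `e'` everywhere and force degree exactly `n`. Moreover all poles
lie on one side of the axis (`im_neg_of_lt_phaseDeriv`): the Pick matrix at `n` nodes with `e' > 0`
is positive definite, while its signature is read off from the imaginary parts of the `β l`. The
phase is then increasing, and a pole near the axis would make it jump by nearly 2π, more than the
error bound permits, or would make it too steep where `e' ≤ 0` is known. -/

/-! ### Unitary functions as quotients `conj U / U` -/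

lemma exists_conj_div_eq {c : ℂ} (hc : ‖c‖ = 1) :
    ∃ γ : ℂ, ‖γ‖ = 1 ∧ c = (starRingEnd ℂ) γ / γ := by
  obtain ⟨z, hz⟩ := IsAlgClosed.exists_pow_nat_eq c (n := 2) two_pos
  have hn : ‖z‖ = 1 := by
    have : ‖z‖ ^ 2 = 1 := by rw [← norm_pow, hz, hc]
    nlinarith [norm_nonneg z]
  have hz0 : z ≠ 0 := by
    intro h
    simp [h] at hn
  -- With `z ^ 2 = c` and `|z| = 1`, one has `z / conj z = z ^ 2`.
  refine ⟨(starRingEnd ℂ) z, by simpa using hn, ?_⟩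
  have h2 : z * (starRingEnd ℂ) z = 1 := by
    rw [Complex.mul_conj, Complex.normSq_eq_norm_sq, hn]
    simp
  have h3 : (starRingEnd ℂ) z ≠ 0 := by simpa using hz0
  rw [Complex.conj_conj, eq_div_iff h3, ← hz]
  linear_combination z * h2

/-- A rational function with modulus one on the real line, in lowest terms, has numerator
proportional to the conjugate of its denominator. -/
lemma exists_conj_mul_of_norm_eq {P Q : ℂ[X]} (hPQ : IsCoprime P Q)
    (h : ∀ x : ℝ, ‖P.eval (x : ℂ)‖ = ‖Q.eval (x : ℂ)‖) :
    ∃ c : ℂ, ‖c‖ = 1 ∧ P = C c * Q.map (starRingEnd ℂ) := by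
  set P' := P.map (starRingEnd ℂ) with hP'
  set Q' := Q.map (starRingEnd ℂ) with hQ'
  have ev : ∀ (R : ℂ[X]) (x : ℝ), (R.map (starRingEnd ℂ)).eval (x : ℂ)
      = (starRingEnd ℂ) (R.eval (x : ℂ)) := by
    intro R x
    have := Polynomial.eval_map_apply (p := R) (starRingEnd ℂ) (x : ℂ)
    rwa [Complex.conj_ofReal] at this
  have mm : ∀ R : ℂ[X], (R.map (starRingEnd ℂ)).map (starRingEnd ℂ) = R := by
    intro R
    rw [Polynomial.map_map]
    have : (starRingEnd ℂ).comp (starRingEnd ℂ) = RingHom.id ℂ := by ext x; simp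
    rw [this, Polynomial.map_id]
  have heq : P * P' = Q * Q' := by
    apply Polynomial.eq_of_infinite_eval_eq
    apply Set.Infinite.mono (s := Set.range ((↑) : ℝ → ℂ))
    · rintro _ ⟨x, rfl⟩
      simp only [Set.mem_ofPred_eq, eval_mul, hP', hQ', ev, Complex.mul_conj,
        Complex.normSq_eq_norm_sq, h]
    · exact Set.infinite_range_of_injective Complex.ofReal_injective
  have hne : ∀ x : ℝ, Q.eval (x : ℂ) ≠ 0 := by
    intro x hx
    have hp : P.eval (x : ℂ) = 0 := by
      rw [← norm_eq_zero, h, hx, norm_zero]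
    obtain ⟨a, b, hab⟩ := hPQ
    have := congrArg (Polynomial.eval (x : ℂ)) hab
    simp [hx, hp] at this
  -- Coprimality turns `P P' = Q Q'` into divisibility both ways, so `P` and `Q'` are associated.
  have h1 : P ∣ Q' := hPQ.dvd_of_dvd_mul_left ⟨P', heq.symm⟩
  have h2 : Q ∣ P' := hPQ.symm.dvd_of_dvd_mul_left ⟨Q', heq⟩
  have h3 : Q' ∣ P := by
    have := Polynomial.map_dvd (starRingEnd ℂ) h2
    rwa [mm] at this
  obtain ⟨u, hu⟩ := associated_of_dvd_dvd h3 h1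
  obtain ⟨c, hc0, hc⟩ := Polynomial.isUnit_iff.1 u.isUnit
  refine ⟨c, ?_, by rw [← hu, ← hc, mul_comm]⟩
  have h0 := h 0
  rw [← hu, ← hc, eval_mul, hQ', ev, eval_C, norm_mul, RCLike.norm_conj] at h0
  have := norm_ne_zero_iff.2 (hne 0)
  field_simp at h0
  exact h0

lemma exists_prod_X_sub_C (Q : ℂ[X]) :
    ∃ β : Fin Q.natDegree → ℂ, Q = C Q.leadingCoeff * ∏ l, (X - C (β l)) := by
  have hs := (IsAlgClosed.splits Q).eq_prod_roots
  have hcard := (IsAlgClosed.splits Q).natDegree_eq_card_roots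
  set L := Q.roots.toList with hL
  have hlen : L.length = Q.natDegree := by rw [hcard, hL, Multiset.length_toList]
  refine ⟨fun l => L.get (Fin.cast hlen.symm l), ?_⟩
  conv_lhs => rw [hs]
  congr 1
  rw [← Multiset.coe_toList Q.roots, ← hL, Multiset.map_coe, Multiset.prod_coe,
    ← Fin.prod_univ_fun_getElem]
  exact Fintype.prod_equiv (finCongr hlen) _ _ (fun i => by simp)

/-- The function `γ ∏ (x - β l)` on the real line. -/
noncomputable def linProd {m : ℕ} (γ : ℂ) (β : Fin m → ℂ) (x : ℝ) : ℂ := γ * ∏ l, ((x : ℂ) - β l)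

lemma val_denom_ne_zero {r : RatFunc ℂ} (hr : IsUnitary r) (x : ℝ) :
    r.denom.eval (Complex.I * x) ≠ 0 := by
  intro h
  have := hr x
  simp [val, RatFunc.eval, eval₂_id, h] at this

/-- Unitary rational functions are quotients `conj U / U` on the imaginary axis. -/
lemma exists_linProd_of_mem {n : ℕ} {r : RatFunc ℂ} (hr : r ∈ unitaryClass n) :
    ∃ m ≤ n, ∃ (β : Fin m → ℂ) (γ : ℂ), (∀ l, (β l).im ≠ 0) ∧ γ ≠ 0 ∧
      ∀ x : ℝ, val r (Complex.I * x)
        = (starRingEnd ℂ) (linProd γ β x) / linProd γ β x := by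
  obtain ⟨⟨p, q, hp, hq, hq0, hrpq⟩, hu⟩ := hr
  set P := r.num.comp (C Complex.I * X) with hP
  set Q := r.denom.comp (C Complex.I * X) with hQ
  have hPe : ∀ x : ℝ, P.eval (x : ℂ) = r.num.eval (Complex.I * x) := by
    intro x; simp [hP, eval_comp]
  have hQe : ∀ x : ℝ, Q.eval (x : ℂ) = r.denom.eval (Complex.I * x) := by
    intro x; simp [hQ, eval_comp]
  have hval : ∀ x : ℝ, val r (Complex.I * x) = P.eval (x : ℂ) / Q.eval (x : ℂ) := by
    intro x
    rw [hPe, hQe, val, RatFunc.eval, eval₂_id, eval₂_id]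
  have hQne : ∀ x : ℝ, Q.eval (x : ℂ) ≠ 0 := fun x => by
    rw [hQe]; exact val_denom_ne_zero hu x
  have hco : IsCoprime P Q := by
    have := (RatFunc.isCoprime_num_denom r).map (Polynomial.compRingHom (C Complex.I * X))
    simpa using this
  obtain ⟨c, hc, hPc⟩ := exists_conj_mul_of_norm_eq hco (fun x => by
    have := hu x
    rw [hval, norm_div, div_eq_one_iff_eq (norm_ne_zero_iff.2 (hQne x))] at this
    exact this)
  obtain ⟨γ, hγ, hcγ⟩ := exists_conj_div_eq hc
  obtain ⟨β, hβ⟩ := exists_prod_X_sub_C Q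
  have hdeg : Q.natDegree ≤ n := by
    have h1 : r.denom.natDegree ≤ n := by
      refine (Polynomial.natDegree_le_of_dvd ?_ hq0).trans hq
      exact (RatFunc.denom_dvd hq0).2 ⟨p, hrpq⟩
    rw [hQ, natDegree_comp, natDegree_C_mul_X _ Complex.I_ne_zero, mul_one]
    exact h1
  have hQl : Q.leadingCoeff ≠ 0 := by
    rw [Ne, leadingCoeff_eq_zero]
    intro h
    exact hQne 0 (by rw [h]; simp)
  have hγ0 : γ ≠ 0 := by
    intro h; simp [h] at hγ
  have hQval : ∀ x : ℝ, Q.eval (x : ℂ) = Q.leadingCoeff * ∏ l, ((x : ℂ) - β l) := by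
    intro x
    conv_lhs => rw [hβ]
    simp [eval_prod]
  refine ⟨Q.natDegree, hdeg, β, γ * Q.leadingCoeff, ?_, mul_ne_zero hγ0 hQl, ?_⟩
  · intro l hl
    apply hQne (β l).re
    rw [hQval, mul_eq_zero]
    right
    apply Finset.prod_eq_zero (Finset.mem_univ l)
    rw [sub_eq_zero]
    apply Complex.ext <;> simp [hl]
  · intro x
    rw [hval, hPc, eval_mul, eval_C]
    have : (Q.map (starRingEnd ℂ)).eval (x : ℂ) = (starRingEnd ℂ) (Q.eval (x : ℂ)) := by
      have := Polynomial.eval_map_apply (p := Q) (starRingEnd ℂ) (x : ℂ)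
      rwa [Complex.conj_ofReal] at this
    rw [this, hcγ, linProd, mul_assoc, ← hQval, map_mul, mul_div_assoc, div_mul_div_comm]

lemma linProd_ne_zero {m : ℕ} {γ : ℂ} {β : Fin m → ℂ} (hβ : ∀ l, (β l).im ≠ 0) (hγ : γ ≠ 0)
    (x : ℝ) : linProd γ β x ≠ 0 := by
  refine mul_ne_zero hγ (Finset.prod_ne_zero_iff.2 fun l _ h => hβ l ?_)
  have := congrArg Complex.im h
  simpa using this

lemma continuous_linProd {m : ℕ} (γ : ℂ) (β : Fin m → ℂ) : Continuous (linProd γ β) := by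
  unfold linProd
  fun_prop

/-! ### The polynomial `Im (conj U · V)` and the difference of two phases -/

lemma exists_im_polynomial (p : ℂ[X]) :
    ∃ q : ℝ[X], q.natDegree ≤ p.natDegree ∧ ∀ x : ℝ, q.eval x = (p.eval (x : ℂ)).im := by
  refine ⟨∑ i ∈ Finset.range (p.natDegree + 1), C (p.coeff i).im * X ^ i, ?_, ?_⟩
  · refine natDegree_sum_le_of_forall_le _ _ fun i hi => ?_
    exact (natDegree_C_mul_X_pow_le _ _).trans (by simpa [Nat.lt_succ_iff] using hi)
  · intro x
    rw [eval_eq_sum_range (p := p), Complex.im_sum, eval_finsetSum]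
    refine Finset.sum_congr rfl fun i _ => ?_
    rw [← Complex.ofReal_pow, Complex.im_mul_ofReal]
    simp

/-- `Im (conj U · V)` is a polynomial on the real line. -/
lemma exists_polynomial_im_conj_mul {m m' : ℕ} (γ γ' : ℂ) (β : Fin m → ℂ) (β' : Fin m' → ℂ) :
    ∃ D : ℝ[X], D.natDegree ≤ m + m' ∧
      ∀ x : ℝ, D.eval x = ((starRingEnd ℂ) (linProd γ β x) * linProd γ' β' x).im := by
  have hdeg : ∀ {k : ℕ} (c : ℂ) (b : Fin k → ℂ),
      (C c * ∏ l, (X - C (b l)) : ℂ[X]).natDegree ≤ k := by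
    intro k c b
    refine (natDegree_C_mul_le _ _).trans ((natDegree_prod_le _ _).trans ?_)
    simp
  obtain ⟨D, hD, hDe⟩ := exists_im_polynomial
    ((C ((starRingEnd ℂ) γ) * ∏ l, (X - C ((starRingEnd ℂ) (β l))))
      * (C γ' * ∏ l, (X - C (β' l))))
  refine ⟨D, hD.trans (natDegree_mul_le.trans (add_le_add (hdeg _ _) (hdeg _ _))), fun x => ?_⟩
  rw [hDe]
  simp [linProd, eval_prod]

/-- The phase of `conj U / U` fixes the argument of `U` only modulo π, so `conj U · V` and `|U| |V|
exp (i (e - f) / 2)` are known to have equal squares. Both are continuous and nonvanishing on the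
preconnected set `S`, hence they agree up to one global sign. -/
lemma exists_sign_im_conj_mul_eq {U V : ℝ → ℂ} {e f : ℝ → ℝ} {ω : ℝ} {S : Set ℝ}
    (hS : IsPreconnected S)
    (hU : Continuous U) (hV : Continuous V) (hU0 : ∀ x, U x ≠ 0) (hV0 : ∀ x, V x ≠ 0)
    (he : ContinuousOn e S) (hf : ContinuousOn f S)
    (hUe : ∀ x ∈ S, (starRingEnd ℂ) (U x) / U x = Complex.exp (Complex.I * (ω * x + e x)))
    (hVf : ∀ x ∈ S, (starRingEnd ℂ) (V x) / V x = Complex.exp (Complex.I * (ω * x + f x))) :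
    ∃ s : ℝ, (s = 1 ∨ s = -1) ∧ ∀ x ∈ S,
      ((starRingEnd ℂ) (U x) * V x).im = s * (‖U x‖ * ‖V x‖ * Real.sin ((e x - f x) / 2)) := by
  set w : ℝ → ℂ := fun x => (starRingEnd ℂ) (U x) * V x with hw
  set v : ℝ → ℂ := fun x => (‖U x‖ * ‖V x‖ : ℝ) * Complex.exp (((e x - f x) / 2 : ℝ) * Complex.I)
    with hv
  have hwc : ContinuousOn w S := by
    have : Continuous w := by
      have := Complex.continuous_conj.comp hU
      exact this.mul hV
    exact this.continuousOn
  have hvc : ContinuousOn v S := by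
    have h1 : ContinuousOn (fun x => ((e x - f x) / 2 : ℝ)) S := (he.sub hf).div_const 2
    have h2 : Continuous fun x => ((‖U x‖ * ‖V x‖ : ℝ) : ℂ) :=
      Complex.continuous_ofReal.comp (hU.norm.mul hV.norm)
    refine h2.continuousOn.mul (Complex.continuous_exp.comp_continuousOn ?_)
    exact (Complex.continuous_ofReal.comp_continuousOn h1).mul continuousOn_const
  have hvim : ∀ x, (v x).im = ‖U x‖ * ‖V x‖ * Real.sin ((e x - f x) / 2) := by
    intro x
    simp only [hv, Complex.im_ofReal_mul, Complex.exp_ofReal_mul_I_im]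
  have hsq : Set.EqOn (w ^ 2) (v ^ 2) S := by
    intro x hx
    simp only [Pi.pow_apply, hv, hw, mul_pow, ← Complex.exp_nat_mul]
    have h1 := hUe x hx
    have h2 := hVf x hx
    rw [div_eq_iff (hU0 x)] at h1
    rw [div_eq_iff (hV0 x)] at h2
    have h3 : Complex.exp ((2 : ℕ) * (((e x - f x) / 2 : ℝ) * Complex.I))
        * Complex.exp (Complex.I * (ω * x + f x)) = Complex.exp (Complex.I * (ω * x + e x)) := by
      rw [← Complex.exp_add]
      congr 1
      push_cast
      ring
    have h4 : ((‖U x‖ : ℝ) : ℂ) ^ 2 = U x * (starRingEnd ℂ) (U x) := by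
      rw [Complex.mul_conj, Complex.normSq_eq_norm_sq]; simp
    have h5 : ((‖V x‖ : ℝ) : ℂ) ^ 2 = V x * (starRingEnd ℂ) (V x) := by
      rw [Complex.mul_conj, Complex.normSq_eq_norm_sq]; simp
    push_cast
    push_cast at h3
    rw [mul_pow, h4, h5, h2]
    have h6 : (starRingEnd ℂ) (U x) ^ 2
        = (starRingEnd ℂ) (U x) * (Complex.exp (Complex.I * (ω * x + e x)) * U x) := by
      rw [← h1, sq]
    rw [h6, ← h3]
    ring
  have hv0 : ∀ {x}, x ∈ S → v x ≠ 0 := by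
    intro x _
    refine mul_ne_zero ?_ (Complex.exp_ne_zero _)
    exact_mod_cast mul_ne_zero (norm_ne_zero_iff.2 (hU0 x)) (norm_ne_zero_iff.2 (hV0 x))
  rcases hS.eq_or_eq_neg_of_sq_eq hwc hvc hsq hv0 with h | h
  · refine ⟨1, Or.inl rfl, fun x hx => ?_⟩
    rw [one_mul, ← hvim, ← h hx]
  · refine ⟨-1, Or.inr rfl, fun x hx => ?_⟩
    have := h hx
    rw [Pi.neg_apply] at this
    change (w x).im = _
    rw [this, Complex.neg_im, hvim, neg_one_mul]

/-! ### Polynomials with alternating signs -/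

section Alternation

variable {N : ℕ} {η : Fin N → ℝ}

lemma prod_erase_sub_eq (hη : StrictMono η) (j : Fin N) :
    ∏ i ∈ Finset.univ.erase j, (η j - η i)
      = (-1) ^ (N - 1) * ((-1) ^ (j : ℕ) * ∏ i ∈ Finset.univ.erase j, |η j - η i|) := by
  have h1 : ∀ i ∈ Finset.univ.erase j,
      η j - η i = (if j < i then (-1 : ℝ) else 1) * |η j - η i| := by
    intro i hi
    split_ifs with h
    · rw [abs_of_neg (sub_neg.2 (hη h))]; ring
    · have : i < j := lt_of_le_of_ne (not_lt.1 h) (Finset.ne_of_mem_erase hi)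
      rw [abs_of_pos (sub_pos.2 (hη this)), one_mul]
  rw [Finset.prod_congr rfl h1, Finset.prod_mul_distrib, ← mul_assoc]
  congr 1
  rw [Finset.prod_ite, Finset.prod_const, Finset.prod_const_one, mul_one]
  have h2 : (Finset.univ.erase j).filter (fun i => j < i) = Finset.Ioi j := by
    ext i
    simp only [Finset.mem_filter, Finset.mem_erase, Finset.mem_univ, and_true, Finset.mem_Ioi]
    exact ⟨fun h => h.2, fun h => ⟨h.ne', h⟩⟩
  rw [h2, Fin.card_Ioi]
  have h3 : N - 1 = (N - 1 - j) + j := by omega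
  conv_rhs => rw [h3]
  rw [pow_add, mul_assoc, ← pow_add, Even.neg_one_pow ⟨(j : ℕ), rfl⟩, mul_one]

/-- Up to sign this is the divided difference of order `N - 1`, the top coefficient of the Lagrange
interpolant, which vanishes on polynomials of degree at most `N - 2`. The denominators `∏ (η j - η
i)` alternate in sign with `j`. -/
lemma sum_alternating_eq_zero (hη : StrictMono η) {D : ℝ[X]} (hD : D.natDegree + 1 < N) :
    ∑ j : Fin N, (-1) ^ (j : ℕ) * D.eval (η j) / ∏ i ∈ Finset.univ.erase j, |η j - η i| = 0 := by
  have hdeg : D.degree < (Finset.univ : Finset (Fin N)).card := by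
    rw [Finset.card_univ, Fintype.card_fin]
    exact degree_le_natDegree.trans_lt (by exact_mod_cast (by omega))
  have h := Lagrange.coeff_eq_sum (s := Finset.univ) hη.injective.injOn hdeg
  rw [Finset.card_univ, Fintype.card_fin, coeff_eq_zero_of_natDegree_lt (by omega)] at h
  have h2 := congrArg (fun z => (-1 : ℝ) ^ (N - 1) * z) h
  simp only [mul_zero, Finset.mul_sum] at h2
  rw [h2]
  refine Finset.sum_congr rfl fun j _ => ?_
  rw [prod_erase_sub_eq hη]
  rcases neg_one_pow_eq_or ℝ (N - 1) with h3 | h3 <;>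
    rcases neg_one_pow_eq_or ℝ (j : ℕ) with h4 | h4 <;> rw [h3, h4] <;> simp [div_neg, neg_div]

lemma not_forall_alternating_pos (hη : StrictMono η) {D : ℝ[X]} (hD : D.natDegree + 1 < N)
    {s : ℝ} (h : ∀ j : Fin N, 0 < s * ((-1) ^ (j : ℕ) * D.eval (η j))) : False := by
  have hsum := congrArg (fun z => s * z) (sum_alternating_eq_zero hη hD)
  simp only [mul_zero, Finset.mul_sum] at hsum
  have : Nonempty (Fin N) := ⟨⟨0, by omega⟩⟩
  refine (Finset.sum_pos (fun j _ => ?_) Finset.univ_nonempty).ne' hsum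
  rw [← mul_div_assoc]
  refine div_pos (h j) (Finset.prod_pos fun i hi => abs_pos.2 (sub_ne_zero.2 fun hij => ?_))
  exact Finset.ne_of_mem_erase hi (hη.injective hij).symm

/-- Stable version of the previous obstruction. The weighted terms sum to zero and none is below
`-T`, so none exceeds `N T` in modulus; Lagrange interpolation carries this from the points to
[-1,1]. The weights `A j` cancel the Lagrange denominators, and each remaining factor `|x - η i|` is
at most 2. -/
lemma abs_eval_le_of_alternating (hη : StrictMono η) {D : ℝ[X]} (hD : D.natDegree + 1 < N)
    {s τ σ : ℝ} (hs : s = 1 ∨ s = -1) (hτ : 0 ≤ τ) (hσ : 0 < σ)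
    (hmem : ∀ j, η j ∈ Set.Icc (-1 : ℝ) 1)
    (hsep : ∀ i j, i ≠ j → σ ≤ |η i - η j|)
    (h : ∀ j : Fin N, -τ ≤ s * ((-1) ^ (j : ℕ) * D.eval (η j))) {x : ℝ} (hx : x ∈ Set.Icc (-1 : ℝ) 1) :
    |D.eval x| ≤ N * (N * (τ / σ ^ (N - 1))) * 2 ^ (N - 1) := by
  set A : Fin N → ℝ := fun j => ∏ i ∈ Finset.univ.erase j, |η j - η i| with hA
  have hcard : ∀ j : Fin N, (Finset.univ.erase j).card = N - 1 := by
    intro j; simp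
  have hAσ : ∀ j, σ ^ (N - 1) ≤ A j := by
    intro j
    rw [← hcard j, ← Finset.prod_const]
    exact Finset.prod_le_prod (fun _ _ => hσ.le)
      (fun i hi => hsep j i (Finset.ne_of_mem_erase hi).symm)
  have hσN : 0 < σ ^ (N - 1) := pow_pos hσ _
  have hApos : ∀ j, 0 < A j := fun j => hσN.trans_le (hAσ j)
  set t : Fin N → ℝ := fun j => s * ((-1) ^ (j : ℕ) * D.eval (η j)) / A j with ht
  have hsum : ∑ j, t j = 0 := by
    have := congrArg (fun z => s * z) (sum_alternating_eq_zero hη hD)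
    simp only [mul_zero, Finset.mul_sum] at this
    rw [← this]
    exact Finset.sum_congr rfl fun j _ => by simp only [ht, hA, mul_div_assoc]
  set T := τ / σ ^ (N - 1) with hT
  have hT0 : 0 ≤ T := div_nonneg hτ hσN.le
  have hlow : ∀ j, -T ≤ t j := by
    intro j
    have h1 : τ / A j ≤ T := div_le_div_of_nonneg_left hτ hσN (hAσ j)
    have h2 : -τ / A j ≤ t j := div_le_div_of_nonneg_right (h j) (hApos j).le
    rw [neg_div] at h2
    linarith
  have hup : ∀ j, |t j| ≤ N * T := by
    intro j
    have hN1 : (1 : ℝ) ≤ N := by exact_mod_cast (by omega)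
    rw [abs_le]
    constructor
    · nlinarith [hlow j]
    · have h1 : t j + ∑ i ∈ Finset.univ.erase j, t i = 0 := by
        rw [Finset.add_sum_erase _ _ (Finset.mem_univ j), hsum]
      have h2 : ∑ i ∈ Finset.univ.erase j, (-T) ≤ ∑ i ∈ Finset.univ.erase j, t i :=
        Finset.sum_le_sum fun i _ => hlow i
      rw [Finset.sum_const, hcard, nsmul_eq_mul] at h2
      have h3 : ((N - 1 : ℕ) : ℝ) ≤ N := by exact_mod_cast (by omega)
      nlinarith
  have hDt : ∀ j, |D.eval (η j)| = |t j| * A j := by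
    intro j
    have hs1 : |s| = 1 := by rcases hs with rfl | rfl <;> simp
    simp only [ht, abs_div, abs_mul, hs1, abs_pow, abs_neg, abs_one, one_pow, one_mul,
      abs_of_pos (hApos j)]
    field_simp [(hApos j).ne']
  have hdeg : D.degree < (Finset.univ : Finset (Fin N)).card := by
    rw [Finset.card_univ, Fintype.card_fin]
    exact degree_le_natDegree.trans_lt (by exact_mod_cast (by omega))
  have hint := Lagrange.eq_interpolate (s := Finset.univ) hη.injective.injOn hdeg
  have hev : D.eval x = ∑ j, D.eval (η j) * ∏ i ∈ Finset.univ.erase j,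
      ((η j - η i)⁻¹ * (x - η i)) := by
    conv_lhs => rw [hint]
    simp [Lagrange.interpolate_apply, eval_finsetSum, Lagrange.basis, Lagrange.basisDivisor,
      eval_prod]
  rw [hev]
  refine (Finset.abs_sum_le_sum_abs _ _).trans ?_
  have hterm : ∀ j ∈ (Finset.univ : Finset (Fin N)), |D.eval (η j) *
      ∏ i ∈ Finset.univ.erase j, ((η j - η i)⁻¹ * (x - η i))| ≤ N * T * 2 ^ (N - 1) := by
    intro j _
    rw [Finset.prod_mul_distrib, abs_mul, abs_mul, Finset.abs_prod, Finset.abs_prod, hDt]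
    simp only [abs_inv, Finset.prod_inv_distrib]
    change |t j| * A j * ((A j)⁻¹ * _) ≤ _
    rw [mul_assoc, mul_inv_cancel_left₀ (hApos j).ne']
    refine mul_le_mul (hup j) ?_ (Finset.prod_nonneg fun _ _ => abs_nonneg _)
      (mul_nonneg (Nat.cast_nonneg _) hT0)
    rw [← hcard j, ← Finset.prod_const]
    refine Finset.prod_le_prod (fun _ _ => abs_nonneg _) fun i _ => ?_
    rw [abs_le]
    constructor <;> linarith [(hmem i).1, (hmem i).2, hx.1, hx.2]
  refine (Finset.sum_le_card_nsmul _ _ _ hterm).trans ?_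
  rw [Finset.card_univ, Fintype.card_fin, nsmul_eq_mul]
  exact le_of_eq (by ring)

end Alternation

/-! ### Phase and phase error -/

/-- The derivative of the phase of `conj U / U` for `U x = γ ∏ (x - β l)`. -/
noncomputable def phaseDeriv {m : ℕ} (β : Fin m → ℂ) (x : ℝ) : ℝ :=
  ∑ l, -2 * (β l).im / Complex.normSq ((x : ℂ) - β l)

lemma ofReal_sub_ne_zero {b : ℂ} (hb : b.im ≠ 0) (x : ℝ) : (x : ℂ) - b ≠ 0 := by
  intro h
  have := congrArg Complex.im h
  simp at this
  exact hb this

lemma hasDerivAt_linProd {m : ℕ} {γ : ℂ} {β : Fin m → ℂ} (hβ : ∀ l, (β l).im ≠ 0) (x : ℝ) :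
    HasDerivAt (linProd γ β) (linProd γ β x * ∑ l, ((x : ℂ) - β l)⁻¹) x := by
  have h1 : ∀ l ∈ (Finset.univ : Finset (Fin m)),
      HasDerivAt (fun y : ℝ => (y : ℂ) - β l) 1 x := fun l _ =>
    (Complex.ofRealCLM.hasDerivAt (x := x)).sub_const (β l)
  have h2 := (HasDerivAt.fun_finsetProd h1).const_mul γ
  refine h2.congr_deriv ?_
  rw [linProd, Finset.mul_sum, Finset.mul_sum]
  refine Finset.sum_congr rfl fun l _ => ?_
  have h0 := ofReal_sub_ne_zero (hβ l) x
  rw [← Finset.mul_prod_erase _ _ (Finset.mem_univ l), smul_eq_mul, mul_one]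
  field_simp

/-- The logarithmic derivative is `conj L - L = -2 i Im L`, where `L` is that of `U`. -/
lemma hasDerivAt_conj_div {m : ℕ} {γ : ℂ} {β : Fin m → ℂ} (hβ : ∀ l, (β l).im ≠ 0) (hγ : γ ≠ 0)
    (x : ℝ) : HasDerivAt (fun y => (starRingEnd ℂ) (linProd γ β y) / linProd γ β y)
      ((starRingEnd ℂ) (linProd γ β x) / linProd γ β x * (Complex.I * phaseDeriv β x)) x := by
  have h1 := hasDerivAt_linProd (γ := γ) hβ x
  have h2 : HasDerivAt (fun y => (starRingEnd ℂ) (linProd γ β y))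
      ((starRingEnd ℂ) (linProd γ β x * ∑ l, ((x : ℂ) - β l)⁻¹)) x := h1.star
  have h0 := linProd_ne_zero hβ hγ x
  refine (h2.fun_div h1 h0).congr_deriv ?_
  set L := ∑ l, ((x : ℂ) - β l)⁻¹ with hL
  have h3 : (starRingEnd ℂ) L - L = Complex.I * phaseDeriv β x := by
    have h4 : L.im = ∑ l, (β l).im / Complex.normSq ((x : ℂ) - β l) := by
      rw [hL, Complex.im_sum]
      refine Finset.sum_congr rfl fun l _ => ?_
      rw [Complex.inv_im]
      simp
    have h5 : phaseDeriv β x = -2 * L.im := by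
      rw [h4, phaseDeriv, Finset.mul_sum]
      exact Finset.sum_congr rfl fun l _ => by rw [mul_div_assoc]
    rw [h5]
    apply Complex.ext <;> simp
    ring
  rw [← h3, map_mul]
  field_simp

lemma eq_of_exp_I_mul_eq {a b : ℝ} (ha : |a| < Real.pi) (hb : |b| < Real.pi)
    (h : Complex.exp (Complex.I * a) = Complex.exp (Complex.I * b)) : a = b := by
  have key : ∀ c : ℝ, |c| < Real.pi → Complex.arg (Complex.exp (Complex.I * c)) = c := by
    intro c hc
    rw [abs_lt] at hc
    rw [mul_comm, Complex.arg_exp_mul_I, toIocMod_eq_self]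
    constructor <;> linarith
  rw [← key a ha, ← key b hb, h]

lemma norm_exp_sub_one_eq {e : ℝ} (he : |e| < Real.pi) :
    ‖Complex.exp (Complex.I * e) - 1‖ = 2 * Real.sin (|e| / 2) := by
  rw [Complex.norm_exp_I_mul_ofReal_sub_one, norm_mul, Real.norm_eq_abs, Real.norm_eq_abs,
    abs_two]
  congr 1
  rcases abs_cases e with ⟨h, h0⟩ | ⟨h, h0⟩
  · rw [h, abs_of_nonneg]
    apply Real.sin_nonneg_of_nonneg_of_le_pi <;> linarith
  · rw [h, neg_div, Real.sin_neg, abs_of_nonpos]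
    apply Real.sin_nonpos_of_nonpos_of_neg_pi_le <;> linarith

/-- `r` equals `conj U / U` on the imaginary axis, with `U x = γ ∏ (x - β l)`, and `e` is the
phase error of `r` on `[-1,1]`. -/
structure IsPhaseRep (ω : ℝ) (r : RatFunc ℂ) {m : ℕ} (γ : ℂ) (β : Fin m → ℂ) (e : ℝ → ℝ) :
    Prop where
  im_ne : ∀ l, (β l).im ≠ 0
  ne_zero : γ ≠ 0
  val_eq : ∀ x : ℝ, val r (Complex.I * x) = (starRingEnd ℂ) (linProd γ β x) / linProd γ β x
  val_eq_exp : ∀ x ∈ Set.Icc (-1 : ℝ) 1, val r (Complex.I * x)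
    = Complex.exp (Complex.I * (ω * x + e x))
  abs_lt_pi : ∀ x ∈ Set.Icc (-1 : ℝ) 1, |e x| < Real.pi
  hasDerivAt : ∀ x ∈ Set.Icc (-1 : ℝ) 1, HasDerivAt e (phaseDeriv β x - ω) x

section

variable {ω : ℝ} {r : RatFunc ℂ} {m : ℕ} {γ : ℂ} {β : Fin m → ℂ} {e : ℝ → ℝ}

lemma pointError_eq (ω : ℝ) (r : RatFunc ℂ) (x : ℝ) : pointError ω r x
    = ‖val r (Complex.I * x) * Complex.exp (-(Complex.I * (ω * x))) - 1‖ := by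
  have h1 : ‖Complex.exp (-(Complex.I * (ω * x)))‖ = 1 := by
    have : -(Complex.I * (ω * x)) = ((-(ω * x) : ℝ) : ℂ) * Complex.I := by push_cast; ring
    rw [this, Complex.norm_exp_ofReal_mul_I]
  rw [pointError, ← mul_one ‖_ - _‖, ← h1, ← norm_mul, sub_mul, ← Complex.exp_add, add_neg_cancel,
    Complex.exp_zero]

lemma IsPhaseRep.pointError_eq (h : IsPhaseRep ω r γ β e) {x : ℝ} (hx : x ∈ Set.Icc (-1 : ℝ) 1) :
    pointError ω r x = 2 * Real.sin (|e x| / 2) := by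
  rw [UnitaryApprox.pointError_eq, h.val_eq_exp x hx, ← norm_exp_sub_one_eq (h.abs_lt_pi x hx),
    ← Complex.exp_add]
  congr 3
  ring

lemma IsPhaseRep.continuousOn (h : IsPhaseRep ω r γ β e) : ContinuousOn e (Set.Icc (-1) 1) :=
  fun x hx => (h.hasDerivAt x hx).continuousAt.continuousWithinAt

/-- The phase error is bounded in terms of the pointwise error. -/
lemma IsPhaseRep.abs_eq (h : IsPhaseRep ω r γ β e) {x : ℝ} (hx : x ∈ Set.Icc (-1 : ℝ) 1) :
    |e x| = 2 * Real.arcsin (pointError ω r x / 2) := by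
  have h1 := h.abs_lt_pi x hx
  rw [h.pointError_eq hx, mul_div_cancel_left₀ _ (two_ne_zero), Real.arcsin_sin]
  · ring
  · linarith [abs_nonneg (e x), Real.pi_pos]
  · linarith

/-- Error below 2 means that `r(ix) exp (-iωx)`, a point of the unit circle, avoids -1. It stays in
the slit plane, where the principal logarithm provides a differentiable phase error. -/
lemma exists_isPhaseRep {n : ℕ} (hr : r ∈ unitaryClass n)
    (h2 : ∀ x ∈ Set.Icc (-1 : ℝ) 1, pointError ω r x < 2) :
    ∃ m ≤ n, ∃ (γ : ℂ) (β : Fin m → ℂ) (e : ℝ → ℝ), IsPhaseRep ω r γ β e := by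
  obtain ⟨m, hm, β, γ, hβ, hγ, hval⟩ := exists_linProd_of_mem hr
  set f : ℝ → ℂ := fun x => (starRingEnd ℂ) (linProd γ β x) / linProd γ β x
    * Complex.exp (-(Complex.I * (ω * x))) with hf
  have hfn : ∀ x, ‖f x‖ = 1 := by
    intro x
    have : -(Complex.I * (ω * x)) = ((-(ω * x) : ℝ) : ℂ) * Complex.I := by push_cast; ring
    simp only [hf]
    rw [norm_mul, ← hval, hr.2 x, this, Complex.norm_exp_ofReal_mul_I, one_mul]
  have hslit : ∀ x ∈ Set.Icc (-1 : ℝ) 1, f x ∈ Complex.slitPlane := by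
    intro x hx
    rw [Complex.mem_slitPlane_iff_not_le_zero]
    intro hle
    have h3 := h2 x hx
    rw [UnitaryApprox.pointError_eq, hval] at h3
    change ‖f x - 1‖ < 2 at h3
    have h4 := hfn x
    rw [Complex.le_def] at hle
    have h5 : f x = ((f x).re : ℂ) := by
      apply Complex.ext <;> simp [hle.2]
    rw [h5, Complex.norm_real, Real.norm_eq_abs, abs_of_nonpos hle.1] at h4
    rw [h5, ← Complex.ofReal_one, ← Complex.ofReal_sub, Complex.norm_real, Real.norm_eq_abs] at h3
    rw [show (f x).re = -1 by linarith] at h3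
    norm_num at h3
  have hexp : ∀ x, Complex.exp (Complex.I * ((Complex.log (f x)).im : ℂ)) = f x := by
    intro x
    have h0 : f x ≠ 0 := by
      intro h; have := hfn x; simp [h] at this
    have h3 : Complex.log (f x) = Complex.I * ((Complex.log (f x)).im : ℂ) := by
      apply Complex.ext
      · simp [Complex.log_re, hfn x]
      · simp
    rw [← h3, Complex.exp_log h0]
  refine ⟨m, hm, γ, β, fun x => (Complex.log (f x)).im, hβ, hγ, hval, ?_, ?_, ?_⟩
  · intro x _
    rw [mul_add, Complex.exp_add, hexp, hval]
    simp only [hf]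
    rw [mul_left_comm, ← Complex.exp_add, add_neg_cancel, Complex.exp_zero, mul_one]
  · intro x hx
    rw [Complex.log_im, abs_lt]
    refine ⟨Complex.neg_pi_lt_arg _, lt_of_le_of_ne (Complex.arg_le_pi _) ?_⟩
    exact (Complex.mem_slitPlane_iff_arg.1 (hslit x hx)).1
  · intro x hx
    have d1 := hasDerivAt_conj_div hβ hγ x
    have d2 : HasDerivAt (fun y : ℝ => Complex.exp (-(Complex.I * (ω * y))))
        (Complex.exp (-(Complex.I * (ω * x))) * -(Complex.I * (ω * 1))) x :=
      (((((Complex.ofRealCLM.hasDerivAt (x := x)).const_mul (ω : ℂ)).const_mul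
        Complex.I)).neg).cexp
    have d3 : HasDerivAt f (f x * (Complex.I * ((phaseDeriv β x - ω : ℝ) : ℂ))) x := by
      refine (d1.mul d2).congr_deriv ?_
      simp only [hf]
      push_cast
      ring
    have d4 := d3.clog_real (hslit x hx)
    have h0 : f x ≠ 0 := by
      intro h; have := hfn x; simp [h] at this
    rw [mul_div_cancel_left₀ _ h0] at d4
    have d5 := (Complex.imCLM.hasFDerivAt (x := Complex.log (f x))).comp_hasDerivAt x d4
    refine d5.congr_deriv ?_
    simp

end

/-! ### Uniform error and interpolants -/

lemma IsPhaseFunction.isUnitary {ω : ℝ} {r : RatFunc ℂ} {g : ℝ → ℝ}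
    (h : IsPhaseFunction ω r g) : IsUnitary r := by
  intro x
  rw [h.1 x, mul_comm, Complex.norm_exp_ofReal_mul_I]

lemma pointError_le_two {r : RatFunc ℂ} (hr : IsUnitary r) (ω x : ℝ) : pointError ω r x ≤ 2 := by
  refine (norm_sub_le _ _).trans ?_
  have : Complex.I * (ω * x) = ((ω * x : ℝ) : ℂ) * Complex.I := by push_cast; ring
  rw [hr x, this, Complex.norm_exp_ofReal_mul_I]
  norm_num

lemma uniformError_eq (ω : ℝ) (r : RatFunc ℂ) :
    uniformError ω r = sSup (pointError ω r '' Set.Icc (-1) 1) := by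
  unfold uniformError supNorm pointError
  congr 2
  funext x
  rw [mul_left_comm]

lemma pointError_le_uniformError {r : RatFunc ℂ} (hr : IsUnitary r) (ω : ℝ) {x : ℝ}
    (hx : x ∈ Set.Icc (-1 : ℝ) 1) : pointError ω r x ≤ uniformError ω r := by
  rw [uniformError_eq]
  refine le_csSup ⟨2, ?_⟩ ⟨x, hx, rfl⟩
  rintro _ ⟨y, _, rfl⟩
  exact pointError_le_two hr ω y

lemma uniformError_le {ω M : ℝ} {r : RatFunc ℂ}
    (h : ∀ x ∈ Set.Icc (-1 : ℝ) 1, pointError ω r x ≤ M) : uniformError ω r ≤ M := by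
  rw [uniformError_eq]
  refine csSup_le ⟨_, 0, by norm_num, rfl⟩ ?_
  rintro _ ⟨y, hy, rfl⟩
  exact h y hy

lemma pointError_nonneg (ω : ℝ) (r : RatFunc ℂ) (x : ℝ) : 0 ≤ pointError ω r x := norm_nonneg _

/-- The index is the least `j` such that all nodes from `j` on exceed `t`. -/
lemma exists_mem_subinterval {m : ℕ} {x : Fin m → ℝ} (hx : StrictMono x) {t : ℝ}
    (ht : t ∈ Set.Icc (-1 : ℝ) 1) (hne : ∀ i, t ≠ x i) :
    ∃ j : Fin (m + 1), t ∈ subinterval x (j : ℕ) := by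
  classical
  have hex : ∃ j : ℕ, ∀ i : Fin m, j ≤ (i : ℕ) → t < x i :=
    ⟨m, fun i hi => absurd i.2 (not_lt.2 hi)⟩
  have hjm : Nat.find hex ≤ m := Nat.find_le fun i hi => absurd i.2 (not_lt.2 hi)
  refine ⟨⟨Nat.find hex, Nat.lt_succ_of_le hjm⟩, ht, ?_, Nat.find_spec hex⟩
  intro i hi
  replace hi : (i : ℕ) < Nat.find hex := hi
  have h1 := Nat.find_min hex (m := Nat.find hex - 1) (by omega)
  push Not at h1
  obtain ⟨k, hk, hkt⟩ := h1
  have hk2 : (k : ℕ) < Nat.find hex := by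
    by_contra hcon
    exact absurd (Nat.find_spec hex k (not_lt.1 hcon)) (not_lt.2 hkt)
  have h2 : x i ≤ x k := hx.monotone (Fin.le_def.2 (by omega))
  exact lt_of_le_of_ne (h2.trans hkt) (fun h => hne i h.symm)

section

variable {n : ℕ} {ω : ℝ} {r : RatFunc ℂ} {x : Fin (2 * n + 1) → ℝ} {η : Fin (2 * n + 2) → ℝ}

lemma IsInterpolant.lt_node (h : IsInterpolant n ω r x η) (j : Fin (2 * n + 1)) :
    η j.castSucc < x j :=
  (h.mem_subinterval j.castSucc).2.2 j le_rfl

lemma IsInterpolant.node_lt (h : IsInterpolant n ω r x η) (j : Fin (2 * n + 1)) :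
    x j < η j.succ :=
  (h.mem_subinterval j.succ).2.1 j (by simp)

lemma IsInterpolant.strictMono_points (h : IsInterpolant n ω r x η) : StrictMono η :=
  Fin.strictMono_iff_lt_succ.2 fun j => (h.lt_node j).trans (h.node_lt j)

lemma IsInterpolant.mem_Icc (h : IsInterpolant n ω r x η) (j : Fin (2 * n + 2)) :
    η j ∈ Set.Icc (-1 : ℝ) 1 :=
  (h.mem_subinterval j).1

lemma IsInterpolant.uniformError_le_iSup (h : IsInterpolant n ω r x η) :
    uniformError ω r ≤ ⨆ k, pointError ω r (η k) := by
  have hb : BddAbove (Set.range fun k => pointError ω r (η k)) := Set.finite_range _ |>.bddAbove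
  refine uniformError_le fun t ht => ?_
  by_cases hne : ∀ i, t ≠ x i
  · obtain ⟨j, hj⟩ := exists_mem_subinterval h.strictMono ht hne
    exact (h.isMax j t hj).trans (le_ciSup hb j)
  · push Not at hne
    obtain ⟨i, rfl⟩ := hne
    have : pointError ω r (x i) = 0 := by
      rw [pointError, h.interpolates i, sub_self, norm_zero]
    rw [this]
    exact (pointError_nonneg _ _ _).trans (le_ciSup hb 0)

lemma IsInterpolant.one_sub_mul_le (h : IsInterpolant n ω r x η) (j : Fin (2 * n + 2)) :
    (1 - errorInUniformity n ω r η) * uniformError ω r ≤ pointError ω r (η j) := by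
  have hinf : (⨅ k, pointError ω r (η k)) ≤ pointError ω r (η j) :=
    ciInf_le (Set.finite_range _).bddBelow j
  have hinf0 : 0 ≤ ⨅ k, pointError ω r (η k) := le_ciInf fun k => pointError_nonneg _ _ _
  have hsup0 : 0 ≤ ⨆ k, pointError ω r (η k) :=
    (pointError_nonneg ω r (η 0)).trans
      (le_ciSup (f := fun k => pointError ω r (η k)) (Set.finite_range _).bddAbove 0)
  rw [errorInUniformity, sub_sub_cancel]
  refine (mul_le_mul_of_nonneg_left h.uniformError_le_iSup (div_nonneg hinf0 hsup0)).trans ?_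
  rcases hsup0.eq_or_lt with h0 | h0
  · rw [← h0, mul_zero]
    exact pointError_nonneg _ _ _
  · rw [div_mul_cancel₀ _ h0.ne']
    exact hinf

/-! ### Alternation of the phase error and the error bounds -/

variable {m : ℕ} {γ : ℂ} {β : Fin m → ℂ} {e : ℝ → ℝ}

lemma IsPhaseRep.exists_sign (h : IsPhaseRep ω r γ β e) (hη : ∀ j, η j ∈ Set.Icc (-1 : ℝ) 1)
    (ha : PhaseErrorAlternates ω r η) :
    ∃ s : ℝ, (s = 1 ∨ s = -1) ∧ ∀ j : Fin (2 * n + 2),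
      s * ((-1) ^ (j : ℕ) * e (η j)) = |e (η j)| := by
  obtain ⟨g, hg, ι, hι, halt⟩ := ha
  have heq : ∀ t ∈ Set.Icc (-1 : ℝ) 1, g t - ω * t = e t := by
    intro t ht
    refine eq_of_exp_I_mul_eq (hg.2 t ht) (h.abs_lt_pi t ht) ?_
    have h1 := hg.1 t
    rw [h.val_eq_exp t ht] at h1
    push_cast
    rw [mul_sub, Complex.exp_sub, ← h1, ← Complex.exp_sub]
    congr 1
    ring
  refine ⟨(-1) ^ (1 + ι), neg_one_pow_eq_or ℝ _, fun j => ?_⟩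
  have h2 := halt j
  rw [heq _ (hη j)] at h2
  rw [h2, abs_mul, abs_pow, abs_neg, abs_one, one_pow, one_mul, abs_abs, ← mul_assoc, ← mul_assoc,
    mul_assoc _ _ ((-1 : ℝ) ^ ((j : ℕ) + 1 + ι)), ← pow_add, ← pow_add]
  rw [Even.neg_one_pow, one_mul]
  exact ⟨1 + ι + j, by ring⟩

lemma IsAlternatingInterpolant.mem_unitaryClass (h : IsAlternatingInterpolant n ω r x η) :
    r ∈ unitaryClass n := by
  obtain ⟨g, hg, _⟩ := h.alternates
  exact ⟨h.interpolant.rational, hg.isUnitary⟩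

lemma IsPhaseRep.exists_polynomial {q : RatFunc ℂ} {m' : ℕ} {γ' : ℂ} {β' : Fin m' → ℂ}
    {f : ℝ → ℝ} (h : IsPhaseRep ω r γ β e) (h' : IsPhaseRep ω q γ' β' f) :
    ∃ D : ℝ[X], D.natDegree ≤ m + m' ∧ ∃ s : ℝ, (s = 1 ∨ s = -1) ∧
      ∀ x ∈ Set.Icc (-1 : ℝ) 1, D.eval x
        = s * (‖linProd γ β x‖ * ‖linProd γ' β' x‖ * Real.sin ((e x - f x) / 2)) := by
  obtain ⟨D, hD, hDe⟩ := exists_polynomial_im_conj_mul γ γ' β β'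
  obtain ⟨s, hs, hse⟩ := exists_sign_im_conj_mul_eq (S := Set.Icc (-1 : ℝ) 1) (ω := ω)
    isPreconnected_Icc (continuous_linProd γ β) (continuous_linProd γ' β')
    (linProd_ne_zero h.im_ne h.ne_zero) (linProd_ne_zero h'.im_ne h'.ne_zero)
    h.continuousOn h'.continuousOn
    (fun x hx => by rw [← h.val_eq, h.val_eq_exp x hx])
    (fun x hx => by rw [← h'.val_eq, h'.val_eq_exp x hx])
  exact ⟨D, hD, s, hs, fun x hx => by rw [hDe, hse x hx]⟩

/-- De la Vallée-Poussin type lower bound for the error of unitary rational functions. -/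
lemma IsAlternatingInterpolant.exists_pointError_le (h : IsAlternatingInterpolant n ω r x η)
    {q : RatFunc ℂ} (hq : q ∈ unitaryClass n) :
    ∃ j, pointError ω r (η j) ≤ uniformError ω q := by
  by_contra! hcon
  have hrm := h.mem_unitaryClass
  have hη := h.interpolant.mem_Icc
  have hr2 : ∀ t ∈ Set.Icc (-1 : ℝ) 1, pointError ω r t < 2 := fun t ht =>
    (pointError_le_uniformError hrm.2 ω ht).trans_lt h.nonmaximal
  have hq2 : ∀ t ∈ Set.Icc (-1 : ℝ) 1, pointError ω q t < 2 := fun t ht =>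
    (pointError_le_uniformError hq.2 ω ht).trans_lt ((hcon 0).trans (hr2 _ (hη 0)))
  obtain ⟨m, hm, γ, β, e, he⟩ := exists_isPhaseRep hrm hr2
  obtain ⟨m', hm', γ', β', f, hf⟩ := exists_isPhaseRep hq hq2
  obtain ⟨s, hs, hse⟩ := he.exists_sign hη h.alternates
  obtain ⟨D, hD, s', hs', hDe⟩ := he.exists_polynomial hf
  -- Here `deg D ≤ m + m' ≤ 2n`, which is just small enough for `2n + 2` points.
  refine not_forall_alternating_pos (N := 2 * n + 2) (s := s * s')
    h.interpolant.strictMono_points (D := D) (by omega) fun j => ?_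
  have hlt : |f (η j)| < |e (η j)| := by
    rw [he.abs_eq (hη j), hf.abs_eq (hη j)]
    have h1 : pointError ω q (η j) < pointError ω r (η j) :=
      (pointError_le_uniformError hq.2 ω (hη j)).trans_lt (hcon j)
    have := Real.arcsin_lt_arcsin (x := pointError ω q (η j) / 2)
      (y := pointError ω r (η j) / 2) (by linarith [pointError_nonneg ω q (η j)]) (by linarith)
      (by linarith [hr2 _ (hη j)])
    linarith
  have hpi := he.abs_lt_pi _ (hη j)
  rw [hDe _ (hη j)]
  have hU := norm_pos_iff.2 (linProd_ne_zero he.im_ne he.ne_zero (η j))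
  have hV := norm_pos_iff.2 (linProd_ne_zero hf.im_ne hf.ne_zero (η j))
  have key : 0 < s * (-1) ^ (j : ℕ) * Real.sin ((e (η j) - f (η j)) / 2) := by
    have hsj := hse j
    rw [← mul_assoc] at hsj
    have hf1 := abs_lt.1 hlt
    have hcase : s * (-1) ^ (j : ℕ) = 1 ∨ s * (-1) ^ (j : ℕ) = -1 := by
      rcases hs with rfl | rfl <;> rcases neg_one_pow_eq_or ℝ (j : ℕ) with h4 | h4 <;>
        simp [h4]
    rcases hcase with hc | hc
    · rw [hc, one_mul] at hsj ⊢
      apply Real.sin_pos_of_pos_of_lt_pi <;> linarith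
    · rw [hc] at hsj ⊢
      rw [neg_one_mul, ← Real.sin_neg]
      apply Real.sin_pos_of_pos_of_lt_pi <;> linarith
  have hss : s' * s' = 1 := by rcases hs' with rfl | rfl <;> norm_num
  calc (0 : ℝ) < (s * (-1) ^ (j : ℕ) * Real.sin ((e (η j) - f (η j)) / 2))
        * (‖linProd γ β (η j)‖ * ‖linProd γ' β' (η j)‖) := mul_pos key (mul_pos hU hV)
    _ = s * s' * ((-1) ^ (j : ℕ) * (s' * (‖linProd γ β (η j)‖ * ‖linProd γ' β' (η j)‖
        * Real.sin ((e (η j) - f (η j)) / 2)))) := by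
      linear_combination (-(s * (-1) ^ (j : ℕ) * Real.sin ((e (η j) - f (η j)) / 2))
        * (‖linProd γ β (η j)‖ * ‖linProd γ' β' (η j)‖)) * hss

theorem IsAlternatingInterpolant.error_bounds {rBest : RatFunc ℂ}
    (hBest : IsUnitaryBestApproximant n ω rBest) (h : IsAlternatingInterpolant n ω r x η) :
    (1 - errorInUniformity n ω r η) * uniformError ω r ≤ uniformError ω rBest ∧
      uniformError ω rBest ≤ uniformError ω r ∧
      |uniformError ω r - uniformError ω rBest| / uniformError ω r
        ≤ errorInUniformity n ω r η := by
  obtain ⟨j, hj⟩ := h.exists_pointError_le hBest.1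
  have h1 := (h.interpolant.one_sub_mul_le j).trans hj
  have h2 := hBest.2 r h.mem_unitaryClass
  refine ⟨h1, h2, ?_⟩
  have h0 : 0 ≤ uniformError ω r := (pointError_nonneg ω r 0).trans
    (pointError_le_uniformError h.mem_unitaryClass.2 ω (by norm_num))
  rw [abs_of_nonneg (sub_nonneg.2 h2)]
  rcases h0.eq_or_lt with h3 | h3
  -- For zero error both quotients are 0 by the convention on division, so the claim is `0 ≤ 1`.
  · rw [← h3, div_zero, errorInUniformity]
    have h4 : (⨅ j, pointError ω r (η j)) = 0 := by
      refine le_antisymm ((ciInf_le (Set.finite_range _).bddBelow 0).trans ?_)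
        (le_ciInf fun k => pointError_nonneg _ _ _)
      rw [h3]
      exact pointError_le_uniformError h.mem_unitaryClass.2 ω (h.interpolant.mem_Icc 0)
    rw [h4, zero_div]
    norm_num
  · rw [div_le_iff₀ h3]
    linarith

end

/-! ### The Pick kernel and the side of the poles -/

/-- The finite Blaschke-type product with the factors `conj (x - β l) / (x - β l)`. -/
noncomputable def blaschke {m : ℕ} (β : Fin m → ℂ) (x : ℝ) : ℂ :=
  ∏ l, (starRingEnd ℂ) ((x : ℂ) - β l) / ((x : ℂ) - β l)

lemma conj_linProd_div {m : ℕ} (γ : ℂ) (β : Fin m → ℂ) (x : ℝ) :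
    (starRingEnd ℂ) (linProd γ β x) / linProd γ β x
      = (starRingEnd ℂ) γ / γ * blaschke β x := by
  rw [linProd, blaschke, map_mul, map_prod, mul_div_mul_comm, Finset.prod_div_distrib]

/-- Splitting off the factor `f` of `β 0` telescopes: `1 - f f' B B' = (1 - f f') + f f' (1 - B
B')`, with primes for conjugate values at `y`. The kernel is thus a sum of `m` rank-one terms whose
signs are those of `-Im (β l)`. The diagonal needs its own formula because the first identity reads
`0 = 0` at `x = y`. -/
lemma exists_pick_kernel : ∀ {m : ℕ} (β : Fin m → ℂ), (∀ l, (β l).im ≠ 0) →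
    ∃ φ : Fin m → ℝ → ℂ,
      (∀ x y : ℝ, Complex.I * (1 - blaschke β x * (starRingEnd ℂ) (blaschke β y))
        = (x - y) * ∑ l, (-2 * (β l).im : ℝ) * (φ l x * (starRingEnd ℂ) (φ l y))) ∧
      ∀ x : ℝ, (phaseDeriv β x : ℂ)
        = ∑ l, (-2 * (β l).im : ℝ) * (φ l x * (starRingEnd ℂ) (φ l x)) := by
  intro m
  induction m with
  | zero =>
    intro β _
    exact ⟨fun l => l.elim0, by simp [blaschke], by simp [phaseDeriv]⟩
  | succ m ih =>
    intro β hβ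
    obtain ⟨φ, h1, h2⟩ := ih (fun l => β l.succ) (fun l => hβ l.succ)
    set f : ℝ → ℂ := fun x => (starRingEnd ℂ) ((x : ℂ) - β 0) / ((x : ℂ) - β 0) with hf
    have h0 := ofReal_sub_ne_zero (hβ 0)
    have h0' : ∀ x : ℝ, (x : ℂ) - (starRingEnd ℂ) (β 0) ≠ 0 := by
      intro x
      have := (map_ne_zero (starRingEnd ℂ)).2 (h0 x)
      rwa [map_sub, Complex.conj_ofReal] at this
    have hff : ∀ x, f x * (starRingEnd ℂ) (f x) = 1 := by
      intro x
      have h3 := h0 x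
      have h4 := h0' x
      simp only [hf, map_div₀, Complex.conj_conj, map_sub, Complex.conj_ofReal]
      field_simp
    have hB : ∀ x, blaschke β x = f x * blaschke (fun l => β l.succ) x := by
      intro x
      rw [blaschke, Fin.prod_univ_succ]
      rfl
    have hβc : β 0 - (starRingEnd ℂ) (β 0) = 2 * (β 0).im * Complex.I := by
      rw [Complex.sub_conj]
      push_cast
      ring
    have hI := Complex.I_mul_I
    refine ⟨Fin.cons (fun x => ((x : ℂ) - β 0)⁻¹) (fun l x => f x * φ l x), ?_, ?_⟩
    · intro x y
      have hx := h0 x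
      have hy' := h0' y
      have h3 : Complex.I * (1 - f x * (starRingEnd ℂ) (f y)) = (x - y) *
          ((-2 * (β 0).im : ℝ) * (((x : ℂ) - β 0)⁻¹ * (starRingEnd ℂ) (((y : ℂ) - β 0)⁻¹))) := by
        simp only [hf, map_div₀, Complex.conj_conj, map_sub, Complex.conj_ofReal, map_inv₀]
        push_cast
        field_simp
        linear_combination Complex.I * (x - y) * hβc + 2 * (β 0).im * (x - y) * hI
      rw [Fin.sum_univ_succ, hB, hB, mul_add]
      simp only [Fin.cons_zero, Fin.cons_succ]
      rw [← h3]
      have h4 : ∑ l : Fin m, ((-2 * (β l.succ).im : ℝ) : ℂ)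
          * (f x * φ l x * (starRingEnd ℂ) (f y * φ l y))
          = f x * (starRingEnd ℂ) (f y) *
            ∑ l : Fin m, ((-2 * (β l.succ).im : ℝ) : ℂ) * (φ l x * (starRingEnd ℂ) (φ l y)) := by
        rw [Finset.mul_sum]
        refine Finset.sum_congr rfl fun l _ => ?_
        rw [map_mul]
        ring
      rw [h4, mul_left_comm, ← h1 x y, map_mul]
      ring
    · intro x
      rw [phaseDeriv, Fin.sum_univ_succ, Fin.sum_univ_succ]
      simp only [Fin.cons_zero, Fin.cons_succ]
      push_cast
      congr 1
      · rw [map_inv₀, div_eq_mul_inv, ← Complex.mul_conj, mul_inv]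
      · have h3 := h2 x
        rw [phaseDeriv] at h3
        push_cast at h3
        rw [h3]
        refine Finset.sum_congr rfl fun l _ => ?_
        rw [map_mul]
        linear_combination (-(-2 * ((β l.succ).im : ℂ) * (φ l x * (starRingEnd ℂ) (φ l x)))) * hff x

lemma integral_exp_I_mul_eq {ω d : ℝ} (hd : d ≠ 0) :
    ∫ t in (0 : ℝ)..ω, Complex.exp (Complex.I * (t * d))
      = Complex.I * (1 - Complex.exp (Complex.I * (ω * d))) / d := by
  have hd' : (d : ℂ) ≠ 0 := by exact_mod_cast hd
  have h1 : Complex.I * (d : ℂ) ≠ 0 := mul_ne_zero Complex.I_ne_zero hd'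
  have h2 := integral_exp_mul_complex (a := 0) (b := ω) h1
  have h3 : ∀ t : ℂ, Complex.I * d * t = Complex.I * (t * d) := fun t => by ring
  simp only [h3] at h2
  rw [h2]
  simp only [Complex.ofReal_zero, zero_mul, mul_zero, Complex.exp_zero]
  field_simp
  linear_combination (-(1 - Complex.exp (Complex.I * ω * d))) * Complex.I_sq

/-- Positive semidefiniteness of the kernel `∫₀^ω exp (i t (a - b)) dt`. -/
lemma re_sum_integral_exp_nonneg {n : ℕ} {ω : ℝ} (hω : 0 ≤ ω) (y : Fin n → ℝ) (u : Fin n → ℂ) :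
    0 ≤ (∑ i, ∑ j, u i * (starRingEnd ℂ) (u j) *
      ∫ t in (0 : ℝ)..ω, Complex.exp (Complex.I * (t * (y i - y j : ℝ)))).re := by
  have hc : ∀ d : ℝ, Continuous fun t : ℝ => Complex.exp (Complex.I * (t * (d : ℂ))) := by
    intro d; fun_prop
  have h1 : (∑ i, ∑ j, u i * (starRingEnd ℂ) (u j) *
      ∫ t in (0 : ℝ)..ω, Complex.exp (Complex.I * (t * (y i - y j : ℝ))))
      = ∫ t in (0 : ℝ)..ω,
        ((Complex.normSq (∑ i, u i * Complex.exp (Complex.I * (t * y i))) : ℝ) : ℂ) := by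
    simp only [← intervalIntegral.integral_const_mul]
    have h2 : ∀ i, ∑ j, ∫ t in (0 : ℝ)..ω, u i * (starRingEnd ℂ) (u j) *
        Complex.exp (Complex.I * (t * (y i - y j : ℝ)))
        = ∫ t in (0 : ℝ)..ω, ∑ j, u i * (starRingEnd ℂ) (u j) *
        Complex.exp (Complex.I * (t * (y i - y j : ℝ))) := by
      intro i
      rw [intervalIntegral.integral_finsetSum]
      exact fun j _ => ((hc _).const_mul _).intervalIntegrable _ _
    rw [Finset.sum_congr rfl fun i _ => h2 i, ← intervalIntegral.integral_finsetSum]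
    · congr 1
      funext t
      rw [← Complex.mul_conj, map_sum, Finset.sum_mul_sum]
      refine Finset.sum_congr rfl fun i _ => Finset.sum_congr rfl fun j _ => ?_
      rw [map_mul, ← Complex.exp_conj, map_mul, map_mul, Complex.conj_I, Complex.conj_ofReal,
        Complex.conj_ofReal, mul_mul_mul_comm, ← Complex.exp_add]
      congr 2
      push_cast
      ring
    · intro i _
      exact (continuous_finsetSum _ fun j _ => (hc _).const_mul _).intervalIntegrable _ _
  rw [h1, intervalIntegral.integral_ofReal, Complex.ofReal_re]
  exact intervalIntegral.integral_nonneg hω fun t _ => Complex.normSq_nonneg _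

/-- If a unitary rational function of degree `n` interpolates `exp (iωx)` at `n` points at which
its phase derivative is larger than `ω`, then all its poles are on the same side. -/
lemma im_neg_of_lt_phaseDeriv {n : ℕ} {ω : ℝ} (hω : 0 ≤ ω) {β : Fin n → ℂ} {γ : ℂ} (hγ : γ ≠ 0)
    (hβ : ∀ l, (β l).im ≠ 0) {y : Fin n → ℝ} (hy : Function.Injective y)
    (hint : ∀ i, (starRingEnd ℂ) (linProd γ β (y i)) / linProd γ β (y i)
      = Complex.exp (Complex.I * (ω * y i)))
    (hd : ∀ i, ω < phaseDeriv β (y i)) (l₀ : Fin n) : (β l₀).im < 0 := by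
  by_contra! hcon
  obtain ⟨φ, h1, h2⟩ := exists_pick_kernel β hβ
  have hγc : (starRingEnd ℂ) γ ≠ 0 := by simpa using hγ
  have hBB : ∀ i j, blaschke β (y i) * (starRingEnd ℂ) (blaschke β (y j))
      = Complex.exp (Complex.I * (ω * (y i - y j : ℝ))) := by
    intro i j
    have hi := hint i
    have hj := congrArg (starRingEnd ℂ) (hint j)
    rw [conj_linProd_div] at hi hj
    rw [map_mul, map_div₀, Complex.conj_conj, ← Complex.exp_conj, map_mul, map_mul, Complex.conj_I,
      Complex.conj_ofReal, Complex.conj_ofReal] at hj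
    have h3 : Complex.exp (Complex.I * (ω * (y i - y j : ℝ)))
        = Complex.exp (Complex.I * (ω * y i)) * Complex.exp (-Complex.I * (ω * y j)) := by
      rw [← Complex.exp_add]
      congr 1
      push_cast
      ring
    rw [h3, ← hi, ← hj]
    field_simp
  -- A vector `u` killed by the `n - 1` functionals with `l ≠ l₀` leaves only the term of `l₀`,
  -- which is nonpositive if `Im (β l₀) ≥ 0`.
  let T : (Fin n → ℂ) →ₗ[ℂ] ({l : Fin n // l ≠ l₀} → ℂ) :=
    LinearMap.pi fun l => ∑ i, φ l (y i) • LinearMap.proj i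
  have hT : ∀ u l, T u l = ∑ i, φ l (y i) * u i := by
    intro u l
    simp [T, LinearMap.pi_apply]
  have hker : LinearMap.ker T ≠ ⊥ := by
    apply LinearMap.ker_ne_bot_of_finrank_lt
    rw [Module.finrank_fintype_fun_eq_card, Module.finrank_fintype_fun_eq_card]
    exact Fintype.card_subtype_lt (x := l₀) (by simp)
  obtain ⟨u, huT, hu0⟩ := Submodule.exists_mem_ne_zero_of_ne_bot hker
  rw [LinearMap.mem_ker] at huT
  set K : Fin n → Fin n → ℂ := fun i j =>
    ∑ l, (-2 * (β l).im : ℝ) * (φ l (y i) * (starRingEnd ℂ) (φ l (y j))) with hK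
  -- Interpolation makes `K` the positive semidefinite kernel of `exp (iωx)` plus a diagonal with
  -- positive entries `phaseDeriv - ω`; hence `K` is positive definite, against the choice of `u`.
  have hKval : ∀ i j, K i j = (∫ t in (0 : ℝ)..ω, Complex.exp (Complex.I * (t * (y i - y j : ℝ))))
      + if i = j then ((phaseDeriv β (y i) - ω : ℝ) : ℂ) else 0 := by
    intro i j
    by_cases hij : i = j
    · subst hij
      have : K i i = phaseDeriv β (y i) := (h2 (y i)).symm
      rw [this, if_pos rfl]
      simp
    · have hne : y i - y j ≠ 0 := sub_ne_zero.2 fun h => hij (hy h)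
      have hne' : ((y i - y j : ℝ) : ℂ) ≠ 0 := by exact_mod_cast hne
      rw [if_neg hij, add_zero, integral_exp_I_mul_eq hne, ← hBB, h1, eq_div_iff hne']
      rw [mul_comm, Complex.ofReal_sub]
  have hsum1 : ∑ i, ∑ j, u i * (starRingEnd ℂ) (u j) * K i j
      = ((∑ l, -2 * (β l).im * Complex.normSq (∑ i, φ l (y i) * u i) : ℝ) : ℂ) := by
    rw [Complex.ofReal_sum]
    simp only [hK, Finset.mul_sum]
    calc _ = ∑ i, ∑ l, ∑ j, u i * (starRingEnd ℂ) (u j) *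
          (((-2 * (β l).im : ℝ) : ℂ) * (φ l (y i) * (starRingEnd ℂ) (φ l (y j)))) :=
          Finset.sum_congr rfl fun i _ => Finset.sum_comm
      _ = ∑ l, ∑ i, ∑ j, u i * (starRingEnd ℂ) (u j) *
          (((-2 * (β l).im : ℝ) : ℂ) * (φ l (y i) * (starRingEnd ℂ) (φ l (y j)))) :=
          Finset.sum_comm
      _ = _ := by
          refine Finset.sum_congr rfl fun l _ => ?_
          rw [Complex.ofReal_mul (_ * _), ← Complex.mul_conj, map_sum, Finset.sum_mul_sum,
            Finset.mul_sum]
          refine Finset.sum_congr rfl fun i _ => ?_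
          rw [Finset.mul_sum]
          refine Finset.sum_congr rfl fun j _ => ?_
          rw [map_mul]
          ring
  have hneg : ∑ l, -2 * (β l).im * Complex.normSq (∑ i, φ l (y i) * u i) ≤ 0 := by
    refine Finset.sum_nonpos fun l _ => ?_
    by_cases hl : l = l₀
    · subst hl
      have := Complex.normSq_nonneg (∑ i, φ l (y i) * u i)
      nlinarith
    · have h3 : ∑ i, φ l (y i) * u i = 0 := by
        rw [← hT u ⟨l, hl⟩, huT]
        rfl
      rw [h3, map_zero, mul_zero]
  have hsum2 : ∑ i, ∑ j, u i * (starRingEnd ℂ) (u j) * K i j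
      = (∑ i, ∑ j, u i * (starRingEnd ℂ) (u j) *
        ∫ t in (0 : ℝ)..ω, Complex.exp (Complex.I * (t * (y i - y j : ℝ))))
        + ((∑ i, Complex.normSq (u i) * (phaseDeriv β (y i) - ω) : ℝ) : ℂ) := by
    simp only [hKval, mul_add, Finset.sum_add_distrib]
    congr 1
    push_cast
    refine Finset.sum_congr rfl fun i _ => ?_
    simp [Complex.mul_conj]
  have hpos : 0 < ∑ i, Complex.normSq (u i) * (phaseDeriv β (y i) - ω) := by
    obtain ⟨i, hi⟩ := Function.ne_iff.1 hu0
    refine Finset.sum_pos' (fun j _ => mul_nonneg (Complex.normSq_nonneg _) ?_)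
      ⟨i, Finset.mem_univ i, mul_pos (Complex.normSq_pos.2 hi) ?_⟩
    · linarith [hd j]
    · linarith [hd i]
  have hre := congrArg Complex.re (hsum1.symm.trans hsum2)
  rw [Complex.ofReal_re, Complex.add_re, Complex.ofReal_re] at hre
  linarith [re_sum_integral_exp_nonneg hω y u]

/-! ### Critical points of the phase error -/

lemma normSq_ofReal_sub (x : ℝ) (b : ℂ) :
    Complex.normSq ((x : ℂ) - b) = (x - b.re) ^ 2 + b.im ^ 2 := by
  rw [Complex.normSq_apply]
  simp
  ring

lemma normSq_ofReal_sub_pos {b : ℂ} (hb : b.im ≠ 0) (x : ℝ) :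
    0 < Complex.normSq ((x : ℂ) - b) :=
  Complex.normSq_pos.2 (ofReal_sub_ne_zero hb x)

/-- A phase derivative of a unitary rational function of degree `m ≤ n` that takes a nonzero value
`2n` times has `m = n` and is determined by these points and the poles. -/
lemma sub_phaseDeriv_eq_prod {m n : ℕ} (hmn : m ≤ n) {β : Fin m → ℂ} (hβ : ∀ l, (β l).im ≠ 0)
    {ω : ℝ} (hω : ω ≠ 0) {ζ : Fin (2 * n) → ℝ} (hζ : Function.Injective ζ)
    (hcrit : ∀ i, phaseDeriv β (ζ i) = ω) :
    m = n ∧ ∀ x, ω - phaseDeriv β x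
      = ω * (∏ i, (x - ζ i)) / ∏ l, Complex.normSq ((x : ℂ) - β l) := by
  set q : Fin m → ℝ[X] := fun l => (X - C (β l).re) ^ 2 + C ((β l).im ^ 2) with hq
  have hqe : ∀ l x, (q l).eval x = Complex.normSq ((x : ℂ) - β l) := by
    intro l x
    rw [normSq_ofReal_sub]
    simp [hq]
  have hqm : ∀ l, (q l).Monic := fun l =>
    ((monic_X_sub_C _).pow 2).add_of_left (by
      rw [degree_pow, degree_X_sub_C]
      exact degree_C_le.trans_lt (by norm_num))
  have hqd : ∀ l, (q l).natDegree = 2 := by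
    intro l
    simp only [hq]
    rw [natDegree_add_C, natDegree_pow, natDegree_X_sub_C]
  -- Clearing denominators in `ω - phaseDeriv` gives `lead + rest`, of degree exactly `2m` with
  -- leading coefficient `ω`. With `2n` known roots this forces `m = n` and the full factorization.
  set rest : ℝ[X] := ∑ l, C (2 * (β l).im) * ∏ i ∈ Finset.univ.erase l, q i with hrest
  set lead : ℝ[X] := C ω * ∏ l, q l with hlead
  have hprodm : (∏ l, q l).Monic := monic_prod_of_monic _ _ fun l _ => hqm l
  have hprodd : (∏ l, q l).natDegree = 2 * m := by
    rw [natDegree_prod_of_monic _ _ fun l _ => hqm l]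
    simp [hqd, mul_comm]
  have hleadd : lead.degree = (2 * m : ℕ) := by
    rw [hlead, degree_C_mul hω, degree_eq_natDegree hprodm.ne_zero, hprodd]
  have hrestd : rest ∈ degreeLT ℝ (2 * m) := by
    refine Submodule.sum_mem _ fun l _ => ?_
    rw [mem_degreeLT]
    refine lt_of_le_of_lt (degree_le_natDegree.trans (Nat.cast_le.2
      (natDegree_C_mul_le _ _))) ?_
    rw [natDegree_prod_of_monic _ _ fun l _ => hqm l]
    simp only [hqd, Finset.sum_const, Finset.card_erase_of_mem (Finset.mem_univ l),
      Finset.card_univ, Fintype.card_fin, smul_eq_mul]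
    have := l.pos
    exact_mod_cast (by omega : (m - 1) * 2 < 2 * m)
  have hPpos : ∀ x : ℝ, 0 < ∏ l, Complex.normSq ((x : ℂ) - β l) := fun x =>
    Finset.prod_pos fun l _ => normSq_ofReal_sub_pos (hβ l) x
  have heval : ∀ x, (lead + rest).eval x
      = (ω - phaseDeriv β x) * ∏ l, Complex.normSq ((x : ℂ) - β l) := by
    intro x
    rw [phaseDeriv, sub_mul, Finset.sum_mul, eval_add, hlead, hrest, eval_finsetSum, sub_eq_add_neg,
      ← Finset.sum_neg_distrib, eval_mul, eval_C, eval_prod]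
    simp only [hqe]
    refine congrArg _ (Finset.sum_congr rfl fun l _ => ?_)
    rw [eval_mul, eval_C, eval_prod, ← Finset.mul_prod_erase _ _ (Finset.mem_univ l)]
    simp only [hqe]
    have := (normSq_ofReal_sub_pos (hβ l) x).ne'
    field_simp
  have hroot : ∀ i, (lead + rest).eval (ζ i) = 0 := by
    intro i
    rw [heval, hcrit, sub_self, zero_mul]
  have hRd : (lead + rest).degree = (2 * m : ℕ) := by
    rw [degree_add_eq_left_of_degree_lt, hleadd]
    rw [hleadd]
    exact mem_degreeLT.1 hrestd
  have hm : m = n := by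
    by_contra hne
    have hlt : m < n := lt_of_le_of_ne hmn hne
    have h0 : lead + rest = 0 :=
      eq_zero_of_degree_lt_of_eval_index_eq_zero Finset.univ (v := ζ) hζ.injOn (by
        rw [hRd, Finset.card_univ, Fintype.card_fin]
        exact_mod_cast (by omega)) fun i _ => hroot i
    rw [h0, degree_zero] at hRd
    exact absurd hRd WithBot.bot_ne_coe
  refine ⟨hm, fun x => ?_⟩
  subst hm
  have hZm : (∏ i, (X - C (ζ i))).Monic := monic_prod_X_sub_C _ _
  have hZd : (∏ i, (X - C (ζ i))).natDegree = 2 * m := by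
    rw [natDegree_prod_of_monic _ _ fun l _ => monic_X_sub_C _]
    simp
  have heq : lead + rest = C ω * ∏ i, (X - C (ζ i)) := by
    refine eq_of_degree_sub_lt_of_eval_index_eq Finset.univ (v := ζ) hζ.injOn ?_ fun i _ => ?_
    · rw [Finset.card_univ, Fintype.card_fin, add_sub_right_comm, ← mem_degreeLT]
      refine Submodule.add_mem _ ?_ hrestd
      have hZd' : (C ω * ∏ i, (X - C (ζ i))).degree = (2 * m : ℕ) := by
        rw [degree_C_mul hω, degree_eq_natDegree hZm.ne_zero, hZd]
      rw [mem_degreeLT, ← hleadd]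
      refine degree_sub_lt_left (hleadd.trans hZd'.symm) ?_ ?_
      · intro h0
        rw [h0, degree_zero] at hleadd
        exact absurd hleadd WithBot.bot_ne_coe
      · rw [hlead, leadingCoeff_mul, leadingCoeff_mul, hprodm.leadingCoeff, hZm.leadingCoeff]
    · rw [hroot, eval_mul, eval_prod, Finset.prod_eq_zero (Finset.mem_univ i) (by simp), mul_zero]
  rw [eq_div_iff (hPpos x).ne', ← heval, heq]
  simp [eval_prod]

lemma prod_sub_nonneg {n : ℕ} {ζ : Fin (2 * n) → ℝ} {x : ℝ}
    (h : (∀ i, x ≤ ζ i) ∨ ∀ i, ζ i ≤ x) : 0 ≤ ∏ i, (x - ζ i) := by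
  rcases h with h | h
  · have h1 : ∏ i, (x - ζ i) = ∏ i, (ζ i - x) := by
      rw [Finset.prod_congr rfl fun i _ => (neg_sub (ζ i) x).symm, Finset.prod_neg]
      simp
    rw [h1]
    exact Finset.prod_nonneg fun i _ => sub_nonneg.2 (h i)
  · exact Finset.prod_nonneg fun i _ => sub_nonneg.2 (h i)

lemma prod_sub_neg_of_odd {n j : ℕ} {ζ : Fin (2 * n) → ℝ} {x : ℝ} (hj : Odd j) (hjn : j ≤ 2 * n)
    (h1 : ∀ i : Fin (2 * n), (i : ℕ) < j → ζ i < x)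
    (h2 : ∀ i : Fin (2 * n), j ≤ (i : ℕ) → x < ζ i) : ∏ i, (x - ζ i) < 0 := by
  have h3 : ∏ i, (x - ζ i)
      = (∏ i : Fin (2 * n), (if (i : ℕ) < j then (1 : ℝ) else -1)) * ∏ i, |x - ζ i| := by
    rw [← Finset.prod_mul_distrib]
    refine Finset.prod_congr rfl fun i _ => ?_
    split_ifs with h
    · rw [abs_of_pos (sub_pos.2 (h1 i h)), one_mul]
    · rw [abs_of_neg (sub_neg.2 (h2 i (not_lt.1 h)))]
      ring
  have h4 : ∏ i : Fin (2 * n), (if (i : ℕ) < j then (1 : ℝ) else -1) = -1 := by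
    rw [Fin.prod_univ_eq_prod_range (fun i => if i < j then (1 : ℝ) else -1)]
    obtain ⟨k, hk⟩ := Nat.exists_eq_add_of_le hjn
    rw [hk, Finset.prod_range_add]
    have hko : Odd k := by
      rcases Nat.even_or_odd k with he | ho
      · exfalso
        have := hj.add_even he
        rw [← hk] at this
        exact Nat.not_odd_iff_even.2 (even_two_mul n) this
      · exact ho
    rw [Finset.prod_congr rfl fun i hi => if_pos (Finset.mem_range.1 hi)]
    simp [hko.neg_one_pow]
  rw [h3, h4, neg_one_mul, neg_lt_zero]
  refine Finset.prod_pos fun i _ => abs_pos.2 ?_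
  rcases lt_or_ge (i : ℕ) j with h | h
  · exact sub_ne_zero.2 (h1 i h).ne'
  · exact sub_ne_zero.2 (h2 i h).ne

section

variable {n : ℕ} {ω : ℝ} {r : RatFunc ℂ} {x : Fin (2 * n + 1) → ℝ} {η : Fin (2 * n + 2) → ℝ}
  {m : ℕ} {γ : ℂ} {β : Fin m → ℂ} {e : ℝ → ℝ}

lemma IsPhaseRep.cos_eq (h : IsPhaseRep ω r γ β e) {t : ℝ} (ht : t ∈ Set.Icc (-1 : ℝ) 1) :
    Real.cos (e t) = 1 - pointError ω r t ^ 2 / 2 := by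
  rw [h.pointError_eq ht, ← Real.cos_abs, mul_pow]
  have h1 := Real.cos_sq' (|e t| / 2)
  have h2 := Real.cos_two_mul (|e t| / 2)
  rw [mul_div_cancel₀ _ (two_ne_zero)] at h2
  linarith

/-- An interior maximum of the error is a local minimum of `cos e = 1 - error ^ 2 / 2`, and `sin e ≠
0` there since `0 < |e| < π`. Only the `2n` inner points qualify, as the two outer ones may be
endpoints. -/
lemma IsInterpolant.phaseDeriv_eq (h : IsInterpolant n ω r x η) (he : IsPhaseRep ω r γ β e)
    (hpos : ∀ j, 0 < pointError ω r (η j)) (i : Fin (2 * n)) :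
    phaseDeriv β (η ⟨i + 1, by omega⟩) = ω := by
  set j : Fin (2 * n + 2) := ⟨i + 1, by omega⟩ with hj
  have h1 : x ⟨i, by omega⟩ < η j := h.node_lt ⟨i, by omega⟩
  have h2 : η j < x ⟨i + 1, by omega⟩ := h.lt_node ⟨i + 1, by omega⟩
  have hm1 := h.mem_Ioo ⟨i, by omega⟩
  have hm2 := h.mem_Ioo ⟨i + 1, by omega⟩
  have hloc : IsLocalMin (fun t => Real.cos (e t)) (η j) := by
    filter_upwards [Ioo_mem_nhds h1 h2] with t ht
    have htI : t ∈ Set.Icc (-1 : ℝ) 1 := ⟨by linarith [hm1.1, ht.1], by linarith [hm2.2, ht.2]⟩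
    have hts : t ∈ subinterval x (j : ℕ) := by
      refine ⟨htI, fun k hk => lt_of_le_of_lt (h.strictMono.monotone ?_) ht.1,
        fun k hk => lt_of_lt_of_le ht.2 (h.strictMono.monotone ?_)⟩
      · exact Fin.le_def.2 (Nat.lt_succ_iff.1 hk)
      · exact Fin.le_def.2 hk
    rw [he.cos_eq htI, he.cos_eq (h.mem_Icc j)]
    have h3 := h.isMax j t hts
    have h4 := pointError_nonneg ω r t
    have := pow_le_pow_left₀ h4 h3 2
    linarith
  have hd := (he.hasDerivAt _ (h.mem_Icc j)).cos
  have h0 := hloc.hasDerivAt_eq_zero hd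
  have hlt := abs_lt.1 (he.abs_lt_pi _ (h.mem_Icc j))
  have hsin : Real.sin (e (η j)) ≠ 0 := by
    intro hs
    rw [Real.sin_eq_zero_iff_of_lt_of_lt hlt.1 hlt.2] at hs
    have := hpos j
    rw [he.pointError_eq (h.mem_Icc j), hs] at this
    simp at this
  have h5 : phaseDeriv β (η j) - ω = 0 := by
    rcases mul_eq_zero.1 h0 with h6 | h6
    · exact absurd (neg_eq_zero.1 h6) hsin
    · exact h6
  linarith

end

/-! ### Uniform bounds on the poles and separation of the points -/

section Poles

variable {n : ℕ} {c : ℝ} {β : Fin n → ℂ}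

lemma phaseDeriv_nonneg (hβ : ∀ l, (β l).im < 0) (t : ℝ) : 0 ≤ phaseDeriv β t :=
  Finset.sum_nonneg fun l _ => div_nonneg (by linarith [hβ l]) (Complex.normSq_nonneg _)

lemma term_le_phaseDeriv (hβ : ∀ l, (β l).im < 0) (l : Fin n) (t : ℝ) :
    -2 * (β l).im / ((t - (β l).re) ^ 2 + (β l).im ^ 2) ≤ phaseDeriv β t := by
  rw [← normSq_ofReal_sub]
  exact Finset.single_le_sum
    (f := fun l => -2 * (β l).im / Complex.normSq ((t : ℂ) - β l))
    (fun i _ => div_nonneg (by linarith [hβ i]) (Complex.normSq_nonneg _)) (Finset.mem_univ l)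

lemma phaseDeriv_le (hc : 0 < c) (hβ : ∀ l, c ≤ -(β l).im) (t : ℝ) :
    phaseDeriv β t ≤ n * (2 / c) := by
  refine (Finset.sum_le_card_nsmul _ _ (2 / c) fun l _ => ?_).trans (by simp)
  have h := hβ l
  rw [normSq_ofReal_sub, div_le_div_iff₀ (by nlinarith [sq_nonneg (t - (β l).re)]) hc]
  nlinarith [sq_nonneg (t - (β l).re)]

lemma norm_linProd_le (γ : ℂ) (hc : 0 < c) (hβ : ∀ l, c ≤ -(β l).im) {s t : ℝ}
    (hs : s ∈ Set.Icc (-1 : ℝ) 1) (ht : t ∈ Set.Icc (-1 : ℝ) 1) :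
    ‖linProd γ β s‖ ≤ (1 + 2 / c) ^ n * ‖linProd γ β t‖ := by
  rw [linProd, linProd, norm_mul, norm_mul, norm_prod, norm_prod, mul_left_comm]
  refine mul_le_mul_of_nonneg_left ?_ (norm_nonneg _)
  have h1 : (1 + 2 / c) ^ n * ∏ l, ‖(t : ℂ) - β l‖ = ∏ l, ((1 + 2 / c) * ‖(t : ℂ) - β l‖) := by
    rw [Finset.prod_mul_distrib]
    simp
  rw [h1]
  refine Finset.prod_le_prod (fun _ _ => norm_nonneg _) fun l _ => ?_
  have h2 : c ≤ ‖(t : ℂ) - β l‖ := by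
    refine (hβ l).trans (le_trans ?_ (Complex.abs_im_le_norm _))
    simpa using neg_le_abs (β l).im
  have h3 : ‖(s : ℂ) - t‖ ≤ 2 := by
    rw [← Complex.ofReal_sub, Complex.norm_real, Real.norm_eq_abs, abs_le]
    constructor <;> linarith [hs.1, hs.2, ht.1, ht.2]
  have h4 : ‖(s : ℂ) - β l‖ ≤ ‖(s : ℂ) - t‖ + ‖(t : ℂ) - β l‖ := norm_sub_le_norm_sub_add_norm_sub _ _ _
  have h5 : 2 ≤ 2 / c * ‖(t : ℂ) - β l‖ := by
    rw [div_mul_eq_mul_div, le_div_iff₀ hc]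
    linarith
  linarith

end Poles

section

variable {n : ℕ} {ω : ℝ} {r : RatFunc ℂ} {x : Fin (2 * n + 1) → ℝ} {η : Fin (2 * n + 2) → ℝ}
  {γ : ℂ} {β : Fin n → ℂ} {e : ℝ → ℝ}

/-- The critical points of the phase error determine the sign of its derivative. -/
lemma IsInterpolant.sub_phaseDeriv_eq (h : IsInterpolant n ω r x η) (hω : 0 < ω) {m : ℕ}
    (hmn : m ≤ n) {β : Fin m → ℂ} (he : IsPhaseRep ω r γ β e)
    (hpos : ∀ j, 0 < pointError ω r (η j)) :
    m = n ∧ ∀ t, ω - phaseDeriv β t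
      = ω * (∏ i : Fin (2 * n), (t - η ⟨i + 1, by omega⟩))
        / ∏ l, Complex.normSq ((t : ℂ) - β l) := by
  refine sub_phaseDeriv_eq_prod hmn he.im_ne hω.ne' ?_ (h.phaseDeriv_eq he hpos)
  intro i k hik
  have := h.strictMono_points.injective hik
  simp only [Fin.mk.injEq] at this
  exact Fin.ext (by omega)

lemma IsInterpolant.phaseDeriv_le_of_outside (h : IsInterpolant n ω r x η) (hω : 0 < ω)
    (he : IsPhaseRep ω r γ β e) (hpos : ∀ j, 0 < pointError ω r (η j)) {t : ℝ}
    (ht : (∀ i : Fin (2 * n), t ≤ η ⟨i + 1, by omega⟩) ∨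
      ∀ i : Fin (2 * n), η ⟨i + 1, by omega⟩ ≤ t) : phaseDeriv β t ≤ ω := by
  have h1 := (h.sub_phaseDeriv_eq hω le_rfl he hpos).2 t
  have h2 := prod_sub_nonneg ht
  have h3 : 0 ≤ ω * (∏ i : Fin (2 * n), (t - η ⟨i + 1, by omega⟩))
      / ∏ l, Complex.normSq ((t : ℂ) - β l) :=
    div_nonneg (mul_nonneg hω.le h2) (Finset.prod_nonneg fun _ _ => Complex.normSq_nonneg _)
  linarith

lemma IsInterpolant.im_neg (h : IsInterpolant n ω r x η) (hω : 0 < ω)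
    (he : IsPhaseRep ω r γ β e) (hpos : ∀ j, 0 < pointError ω r (η j)) (l : Fin n) :
    (β l).im < 0 := by
  -- Every second node is used: an odd number `2 i + 1` of the critical points lies to the left of
  -- `x (2 i + 1)`, so `ω - phaseDeriv` is negative there.
  refine im_neg_of_lt_phaseDeriv hω.le he.ne_zero he.im_ne
    (y := fun i : Fin n => x ⟨2 * i + 1, by omega⟩) ?_ ?_ ?_ l
  · intro i k hik
    have := h.strictMono.injective hik
    simp only [Fin.mk.injEq] at this
    exact Fin.ext (by omega)
  · intro i
    rw [← he.val_eq, h.interpolates]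
  · intro i
    have h1 := (h.sub_phaseDeriv_eq hω le_rfl he hpos).2 (x ⟨2 * i + 1, by omega⟩)
    have h2 : ∏ k : Fin (2 * n), (x ⟨2 * i + 1, by omega⟩ - η ⟨k + 1, by omega⟩) < 0 := by
      refine prod_sub_neg_of_odd (j := 2 * i + 1) ⟨i, rfl⟩ (by omega) (fun k hk => ?_)
        fun k hk => ?_
      · refine lt_of_le_of_lt (h.strictMono_points.monotone ?_) (h.lt_node ⟨2 * i + 1, by omega⟩)
        exact Fin.le_def.2 (by simpa using hk)
      · refine lt_of_lt_of_le (h.node_lt ⟨2 * i + 1, by omega⟩) (h.strictMono_points.monotone ?_)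
        exact Fin.le_def.2 (by simpa using hk)
    have h3 : ω * (∏ k : Fin (2 * n), (x ⟨2 * i + 1, by omega⟩ - η ⟨k + 1, by omega⟩))
        / ∏ l, Complex.normSq ((x ⟨2 * i + 1, by omega⟩ : ℂ) - β l) < 0 :=
      div_neg_of_neg_of_pos (mul_neg_of_pos_of_neg hω h2)
        (Finset.prod_pos fun l _ => normSq_ofReal_sub_pos (he.im_ne l) _)
    linarith

lemma IsPhaseRep.two_mul_le_abs_sub (he : IsPhaseRep ω r γ β e)
    (hη : ∀ j, η j ∈ Set.Icc (-1 : ℝ) 1) (ha : PhaseErrorAlternates ω r η) {A : ℝ}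
    (hA : ∀ j, A ≤ |e (η j)|) (j : Fin (2 * n + 1)) :
    2 * A ≤ |e (η j.castSucc) - e (η j.succ)| := by
  obtain ⟨s, hs, hse⟩ := he.exists_sign hη ha
  have h1 := hse j.castSucc
  have h2 := hse j.succ
  have h3 := hA j.castSucc
  have h4 := hA j.succ
  rw [Fin.val_succ, pow_succ] at h2
  rw [Fin.val_castSucc] at h1
  rw [← h1] at h3
  rw [← h2] at h4
  have hcase : s * (-1) ^ (j : ℕ) = 1 ∨ s * (-1) ^ (j : ℕ) = -1 := by
    rcases hs with rfl | rfl <;> rcases neg_one_pow_eq_or ℝ (j : ℕ) with h4 | h4 <;>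
      simp [h4]
  have h5 : 2 * A ≤ s * (-1) ^ (j : ℕ) * (e (η j.castSucc) - e (η j.succ)) := by linarith
  rcases hcase with hc | hc
  · rw [hc, one_mul] at h5
    exact h5.trans (le_abs_self _)
  · rw [hc, neg_one_mul] at h5
    exact h5.trans (neg_le_abs _)

lemma IsPhaseRep.monotoneOn_add (he : IsPhaseRep ω r γ β e) (hβ : ∀ l, (β l).im < 0) :
    MonotoneOn (fun t => e t + ω * t) (Set.Icc (-1) 1) := by
  have hd : ∀ t ∈ Set.Icc (-1 : ℝ) 1, HasDerivAt (fun t => e t + ω * t) (phaseDeriv β t) t := by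
    intro t ht
    refine ((he.hasDerivAt t ht).add ((hasDerivAt_id t).const_mul ω)).congr_deriv ?_
    simp
  refine monotoneOn_of_deriv_nonneg (convex_Icc _ _)
    (fun t ht => (hd t ht).continuousAt.continuousWithinAt)
    (fun t ht => (hd t (interior_subset ht)).differentiableAt.differentiableWithinAt)
    fun t ht => ?_
  rw [(hd t (interior_subset ht)).deriv]
  exact phaseDeriv_nonneg hβ t

/-- The arctangent term is the phase of the factor of `β l` alone; what remains is the phase of the
other factors, which also increases. -/
lemma IsPhaseRep.monotoneOn_sub_arctan (he : IsPhaseRep ω r γ β e) (hβ : ∀ l, (β l).im < 0)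
    (l : Fin n) :
    MonotoneOn (fun t => e t + ω * t - 2 * Real.arctan ((t - (β l).re) / -(β l).im))
      (Set.Icc (-1) 1) := by
  have hd : ∀ t ∈ Set.Icc (-1 : ℝ) 1,
      HasDerivAt (fun t => e t + ω * t - 2 * Real.arctan ((t - (β l).re) / -(β l).im))
        (phaseDeriv β t - -2 * (β l).im / ((t - (β l).re) ^ 2 + (β l).im ^ 2)) t := by
    intro t ht
    have h1 := ((((hasDerivAt_id t).sub_const (β l).re).div_const (-(β l).im)).arctan).const_mul 2
    refine (((he.hasDerivAt t ht).add ((hasDerivAt_id t).const_mul ω)).sub h1).congr_deriv ?_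
    have h2 : (β l).im ≠ 0 := (hβ l).ne
    have h3 : (t - (β l).re) ^ 2 + (β l).im ^ 2 ≠ 0 := by positivity
    simp only [id, mul_one]
    have h4 : 1 + ((t - (β l).re) / -(β l).im) ^ 2
        = ((t - (β l).re) ^ 2 + (β l).im ^ 2) / (β l).im ^ 2 := by
      field_simp
      ring
    rw [h4]
    field_simp
    ring
  refine monotoneOn_of_deriv_nonneg (convex_Icc _ _)
    (fun t ht => (hd t ht).continuousAt.continuousWithinAt)
    (fun t ht => (hd t (interior_subset ht)).differentiableAt.differentiableWithinAt)
    fun t ht => ?_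
  rw [(hd t (interior_subset ht)).deriv]
  exact sub_nonneg.2 (term_le_phaseDeriv hβ l t)

lemma IsPhaseRep.antitoneOn (he : IsPhaseRep ω r γ β e) {a b : ℝ}
    (ha : a ∈ Set.Icc (-1 : ℝ) 1) (hb : b ∈ Set.Icc (-1 : ℝ) 1)
    (h : ∀ t ∈ Set.Icc a b, phaseDeriv β t ≤ ω) : AntitoneOn e (Set.Icc a b) := by
  have hsub : Set.Icc a b ⊆ Set.Icc (-1 : ℝ) 1 := Set.Icc_subset_Icc ha.1 hb.2
  refine antitoneOn_of_deriv_nonpos (convex_Icc _ _) (he.continuousOn.mono hsub)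
    (fun t ht => (he.hasDerivAt t (hsub (interior_subset ht))).differentiableAt.differentiableWithinAt)
    fun t ht => ?_
  rw [(he.hasDerivAt t (hsub (interior_subset ht))).deriv]
  exact sub_nonpos.2 (h t (interior_subset ht))

/-- A lower bound for the distance of the poles to the imaginary axis. -/
lemma exists_pole_bound {ω A M : ℝ} (hω : 0 < ω) (hA : 0 < A) (hM : M < Real.pi) :
    ∃ c : ℝ, 0 < c ∧ ∀ {n : ℕ} {r : RatFunc ℂ} {x : Fin (2 * n + 1) → ℝ}
      {η : Fin (2 * n + 2) → ℝ} {γ : ℂ} {β : Fin n → ℂ} {e : ℝ → ℝ},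
      IsAlternatingInterpolant n ω r x η → IsPhaseRep ω r γ β e →
      (∀ j, 0 < pointError ω r (η j)) → (∀ j, A ≤ |e (η j)|) →
      (∀ t ∈ Set.Icc (-1 : ℝ) 1, |e t| ≤ M) → ∀ l, c ≤ -(β l).im := by
  -- The first bound keeps `[Re β - ρ, Re β + ρ]` inside [-1,1] when `Re β` lies between the extreme
  -- critical points; the second gives `2 ω ρ ≤ π - M`, so that the total phase gain there, at most
  -- `2 M + 2 ω ρ`, is at most `π + M < 2π`.
  set ρ := min (2 * A / ω) ((Real.pi - M) / (2 * ω)) with hρ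
  have hρ0 : 0 < ρ := lt_min (by positivity) (div_pos (by linarith) (by linarith))
  set T := max 1 (Real.tan ((Real.pi + M) / 4)) with hT
  have hT0 : 0 < T := lt_max_of_lt_left one_pos
  refine ⟨min (2 / ω) (ρ / T), lt_min (by positivity) (by positivity), ?_⟩
  intro n r x η γ β e h he hpos hAe hMe l
  have hi := h.interpolant
  have hβ := hi.im_neg hω he hpos
  have hl := hβ l
  have hη := hi.mem_Icc
  have hmono := hi.strictMono_points
  have hn : 0 < n := l.pos
  -- Outside the range of the critical points the phase derivative at `Re β` is at most `ω`, while
  -- the term of `β` alone is `2 / |Im β|` there.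
  by_cases hout : (∀ i : Fin (2 * n), (β l).re ≤ η ⟨i + 1, by omega⟩) ∨
      ∀ i : Fin (2 * n), η ⟨i + 1, by omega⟩ ≤ (β l).re
  · refine (min_le_left _ _).trans ?_
    have h1 := (term_le_phaseDeriv hβ l (β l).re).trans
      (hi.phaseDeriv_le_of_outside hω he hpos hout)
    rw [sub_self, zero_pow two_ne_zero, zero_add, div_le_iff₀ (sq_pos_of_neg hl)] at h1
    rw [div_le_iff₀ hω]
    nlinarith
  · refine (min_le_right _ _).trans ?_
    push Not at hout
    obtain ⟨⟨i, hi1⟩, ⟨k, hk1⟩⟩ := hout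
    have hb1 : η ⟨1, by omega⟩ < (β l).re :=
      lt_of_le_of_lt (hmono.monotone (Fin.le_def.2 (by simp))) hi1
    have hb2 : (β l).re < η ⟨2 * n, by omega⟩ :=
      lt_of_lt_of_le hk1 (hmono.monotone (Fin.le_def.2 (by simp)))
    have hmon := he.monotoneOn_add hβ
    have hM0 : 0 ≤ M := (abs_nonneg _).trans (hMe 0 (by norm_num))
    have hρ1 : ρ * ω ≤ 2 * A := by
      rw [← le_div_iff₀ hω]
      exact min_le_left _ _
    have hρ2 : 2 * ω * ρ ≤ Real.pi - M := by
      rw [mul_comm, ← le_div_iff₀ (by positivity)]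
      exact min_le_right _ _
    -- On the outer interval `e` decreases by at least `2 A`, but no faster than at rate `ω` because
    -- `e + ω t` increases.
    have hleft : ρ ≤ η ⟨1, by omega⟩ - η ⟨0, by omega⟩ := by
      have hle : η ⟨0, by omega⟩ ≤ η ⟨1, by omega⟩ := hmono.monotone (Fin.le_def.2 (by simp))
      have ha := he.antitoneOn (hη ⟨0, by omega⟩) (hη ⟨1, by omega⟩) fun t ht =>
        hi.phaseDeriv_le_of_outside hω he hpos (Or.inl fun i =>
          ht.2.trans (hmono.monotone (Fin.le_def.2 (by simp))))
      have h1 := ha (Set.left_mem_Icc.2 hle) (Set.right_mem_Icc.2 hle) hle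
      have h2 := he.two_mul_le_abs_sub hη h.alternates hAe ⟨0, by omega⟩
      change 2 * A ≤ |e (η ⟨0, by omega⟩) - e (η ⟨1, by omega⟩)| at h2
      rw [abs_of_nonneg (sub_nonneg.2 h1)] at h2
      have h3 := hmon (hη ⟨0, by omega⟩) (hη ⟨1, by omega⟩) hle
      simp only at h3
      nlinarith
    have hright : ρ ≤ η ⟨2 * n + 1, by omega⟩ - η ⟨2 * n, by omega⟩ := by
      have hle : η ⟨2 * n, by omega⟩ ≤ η ⟨2 * n + 1, by omega⟩ :=
        hmono.monotone (Fin.le_def.2 (by simp))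
      have ha := he.antitoneOn (hη ⟨2 * n, by omega⟩) (hη ⟨2 * n + 1, by omega⟩) fun t ht =>
        hi.phaseDeriv_le_of_outside hω he hpos (Or.inr fun i =>
          le_trans (hmono.monotone (Fin.le_def.2 (by simp))) ht.1)
      have h1 := ha (Set.left_mem_Icc.2 hle) (Set.right_mem_Icc.2 hle) hle
      have h2 := he.two_mul_le_abs_sub hη h.alternates hAe ⟨2 * n, by omega⟩
      change 2 * A ≤ |e (η ⟨2 * n, by omega⟩) - e (η ⟨2 * n + 1, by omega⟩)| at h2
      rw [abs_of_nonneg (sub_nonneg.2 h1)] at h2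
      have h3 := hmon (hη ⟨2 * n, by omega⟩) (hη ⟨2 * n + 1, by omega⟩) hle
      simp only at h3
      nlinarith
    have hm1 : (β l).re - ρ ∈ Set.Icc (-1 : ℝ) 1 :=
      ⟨by linarith [(hη ⟨0, by omega⟩).1], by linarith [(hη ⟨2 * n + 1, by omega⟩).2]⟩
    have hm2 : (β l).re + ρ ∈ Set.Icc (-1 : ℝ) 1 :=
      ⟨by linarith [(hη ⟨0, by omega⟩).1], by linarith [(hη ⟨2 * n + 1, by omega⟩).2]⟩
    have h4 := he.monotoneOn_sub_arctan hβ l hm1 hm2 (by linarith)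
    simp only at h4
    rw [show (β l).re - ρ - (β l).re = -ρ by ring, show (β l).re + ρ - (β l).re = ρ by ring,
      neg_div, Real.arctan_neg] at h4
    have h5 := abs_le.1 (hMe _ hm1)
    have h6 := abs_le.1 (hMe _ hm2)
    -- The factor of `β l` contributes `4 arctan (ρ / |Im β|)` to the phase gain.
    have h7 : Real.arctan (ρ / -(β l).im) ≤ (Real.pi + M) / 4 := by linarith
    have h8 : ρ / -(β l).im ≤ T := by
      by_contra! hcon
      have h9 : Real.tan ((Real.pi + M) / 4) < ρ / -(β l).im := (le_max_right _ _).trans_lt hcon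
      have h10 := Real.arctan_strictMono h9
      rw [Real.arctan_tan (by linarith [Real.pi_pos]) (by linarith)] at h10
      linarith
    rw [div_le_iff₀ (by linarith)] at h8
    rw [div_le_iff₀ hT0]
    linarith

/-- Between neighbouring points `e` changes by at least `2 A`, and the pole bound makes `e`
Lipschitz with constant `n (2 / c) + ω`. -/
lemma IsAlternatingInterpolant.separated (h : IsAlternatingInterpolant n ω r x η)
    (he : IsPhaseRep ω r γ β e) (hω : 0 < ω) {A c : ℝ} (hc : 0 < c) (hAe : ∀ j, A ≤ |e (η j)|)
    (hβc : ∀ l, c ≤ -(β l).im) (i j : Fin (2 * n + 2)) (hij : i ≠ j) :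
    2 * A / (n * (2 / c) + ω) ≤ |η i - η j| := by
  have hη := h.interpolant.mem_Icc
  have hmono := h.interpolant.strictMono_points
  have hβ : ∀ l, (β l).im < 0 := fun l => by linarith [hβc l]
  set K := n * (2 / c) + ω with hK
  have hK0 : 0 < K := by positivity
  have hlip : ∀ s ∈ Set.Icc (-1 : ℝ) 1, ∀ t ∈ Set.Icc (-1 : ℝ) 1, ‖e t - e s‖ ≤ K * ‖t - s‖ := by
    intro s hs t ht
    refine Convex.norm_image_sub_le_of_norm_hasDerivWithin_le
      (fun y hy => (he.hasDerivAt y hy).hasDerivWithinAt) (fun y _ => ?_) (convex_Icc _ _) hs ht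
    have h1 := phaseDeriv_nonneg hβ y
    have h2 := phaseDeriv_le hc hβc y
    rw [Real.norm_eq_abs, abs_le]
    constructor
    · have : 0 ≤ (n : ℝ) * (2 / c) := by positivity
      linarith
    · linarith
  have hstep : ∀ k : Fin (2 * n + 1), 2 * A / K ≤ η k.succ - η k.castSucc := by
    intro k
    have h1 := he.two_mul_le_abs_sub hη h.alternates hAe k
    have h2 := hlip _ (hη k.succ) _ (hη k.castSucc)
    have h3 : η k.castSucc < η k.succ := hmono k.castSucc_lt_succ
    rw [Real.norm_eq_abs, Real.norm_eq_abs, abs_sub_comm (η _), abs_of_pos (sub_pos.2 h3)] at h2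
    rw [div_le_iff₀ hK0, mul_comm]
    linarith
  have hlt : ∀ i j : Fin (2 * n + 2), i < j → 2 * A / K ≤ |η i - η j| := by
    intro i j hij
    have hi2 : (i : ℕ) < 2 * n + 1 := by omega
    have h1 := hstep ⟨i, hi2⟩
    have h2 : η (Fin.succ ⟨i, hi2⟩) ≤ η j := hmono.monotone (Fin.le_def.2 (by simp; omega))
    have h3 : η (Fin.castSucc ⟨i, hi2⟩) = η i := rfl
    rw [abs_sub_comm]
    refine le_trans ?_ (le_abs_self _)
    linarith
  rcases lt_or_gt_of_ne hij with hlt' | hlt'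
  · exact hlt i j hlt'
  · rw [abs_sub_comm]
    exact hlt j i hlt'

end

/-! ### Convergence to the best approximant -/

lemma supNorm_nonneg (f : ℂ → ℂ) : 0 ≤ supNorm f := by
  refine Real.sSup_nonneg ?_
  rintro _ ⟨t, _, rfl⟩
  exact norm_nonneg _

lemma supNorm_le {f : ℂ → ℂ} {M : ℝ}
    (h : ∀ t ∈ Set.Icc (-1 : ℝ) 1, ‖f (Complex.I * t)‖ ≤ M) : supNorm f ≤ M := by
  refine csSup_le ⟨_, 0, by norm_num, rfl⟩ ?_
  rintro _ ⟨t, ht, rfl⟩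
  exact h t ht

lemma exists_norm_le_mul_norm {m : ℕ} {γ : ℂ} {β : Fin m → ℂ} (hβ : ∀ l, (β l).im ≠ 0)
    (hγ : γ ≠ 0) : ∃ M : ℝ, 0 < M ∧ ∀ s ∈ Set.Icc (-1 : ℝ) 1, ∀ t ∈ Set.Icc (-1 : ℝ) 1,
      ‖linProd γ β s‖ ≤ M * ‖linProd γ β t‖ := by
  have hc : ContinuousOn (fun t => ‖linProd γ β t‖) (Set.Icc (-1 : ℝ) 1) :=
    (continuous_linProd γ β).norm.continuousOn
  have hne : (Set.Icc (-1 : ℝ) 1).Nonempty := ⟨0, by norm_num⟩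
  obtain ⟨a, _, hmax⟩ := isCompact_Icc.exists_isMaxOn hne hc
  obtain ⟨b, _, hmin⟩ := isCompact_Icc.exists_isMinOn hne hc
  have ha := norm_pos_iff.2 (linProd_ne_zero hβ hγ a)
  have hb := norm_pos_iff.2 (linProd_ne_zero hβ hγ b)
  refine ⟨‖linProd γ β a‖ / ‖linProd γ β b‖, div_pos ha hb, fun s hs t ht => ?_⟩
  have h1 : ‖linProd γ β s‖ ≤ ‖linProd γ β a‖ := hmax hs
  have h2 : ‖linProd γ β b‖ ≤ ‖linProd γ β t‖ := hmin ht
  rw [div_mul_eq_mul_div, le_div_iff₀ hb]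
  exact mul_le_mul h1 h2 hb.le ha.le

lemma IsPhaseRep.norm_val_sub_eq {ω : ℝ} {r q : RatFunc ℂ} {m m' : ℕ} {γ γ' : ℂ} {β : Fin m → ℂ}
    {β' : Fin m' → ℂ} {e f : ℝ → ℝ} (he : IsPhaseRep ω r γ β e) (hf : IsPhaseRep ω q γ' β' f)
    {t : ℝ} (ht : t ∈ Set.Icc (-1 : ℝ) 1) :
    ‖val r (Complex.I * t) - val q (Complex.I * t)‖ = 2 * |Real.sin ((e t - f t) / 2)| := by
  have h1 : val r (Complex.I * t) - val q (Complex.I * t)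
      = (Complex.exp (Complex.I * ((e t - f t : ℝ) : ℂ)) - 1) * val q (Complex.I * t) := by
    rw [he.val_eq_exp t ht, hf.val_eq_exp t ht, sub_mul, one_mul, ← Complex.exp_add]
    congr 2
    push_cast
    ring
  have h2 : ‖val q (Complex.I * t)‖ = 1 := by
    have : Complex.I * (ω * t + f t) = ((ω * t + f t : ℝ) : ℂ) * Complex.I := by push_cast; ring
    rw [hf.val_eq_exp t ht, this, Complex.norm_exp_ofReal_mul_I]
  rw [h1, norm_mul, h2, mul_one, Complex.norm_exp_I_mul_ofReal_sub_one, norm_mul,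
    Real.norm_eq_abs, Real.norm_eq_abs, abs_two]

/-- A quantitative form of the uniqueness of the unitary best approximant: the distance of a
nearly uniform interpolant to `q` is controlled by the defect of the alternation of the difference
of the phase errors. -/
lemma exists_abs_sin_le (n : ℕ) {ω A M : ℝ} (hω : 0 < ω) (hA : 0 < A) (hM : M < Real.pi)
    {q : RatFunc ℂ} {m' : ℕ} (hm' : m' ≤ n) {γ' : ℂ} {β' : Fin m' → ℂ} {f : ℝ → ℝ}
    (hf : IsPhaseRep ω q γ' β' f) :
    ∃ C : ℝ, ∀ {r : RatFunc ℂ} {x : Fin (2 * n + 1) → ℝ} {η : Fin (2 * n + 2) → ℝ} {m : ℕ}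
      {γ : ℂ} {β : Fin m → ℂ} {e : ℝ → ℝ} {s τ : ℝ},
      IsAlternatingInterpolant n ω r x η → m ≤ n → IsPhaseRep ω r γ β e →
      (∀ j, 0 < pointError ω r (η j)) → (∀ j, A ≤ |e (η j)|) →
      (∀ t ∈ Set.Icc (-1 : ℝ) 1, |e t| ≤ M) → (s = 1 ∨ s = -1) → 0 ≤ τ →
      (∀ j : Fin (2 * n + 2), -τ ≤ s * (-1) ^ (j : ℕ) * Real.sin ((e (η j) - f (η j)) / 2)) →
      ∀ t ∈ Set.Icc (-1 : ℝ) 1, |Real.sin ((e t - f t) / 2)| ≤ C * τ := by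
  obtain ⟨c, hc, hpole⟩ := exists_pole_bound hω hA hM
  obtain ⟨M', hM'0, hM'⟩ := exists_norm_le_mul_norm hf.im_ne hf.ne_zero
  set σ := 2 * A / (n * (2 / c) + ω) with hσ
  have hσ0 : 0 < σ := by positivity
  set M₁ := (1 + 2 / c) ^ n with hM₁
  have hM₁0 : 0 < M₁ := by positivity
  set N := 2 * n + 2 with hN
  refine ⟨N * (N * (M₁ * M' / σ ^ (N - 1))) * 2 ^ (N - 1), ?_⟩
  intro r x η m γ β e s τ h hm he hpos hAe hMe hs hτ halt t ht
  obtain ⟨rfl, -⟩ := h.interpolant.sub_phaseDeriv_eq hω hm he hpos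
  have hβc := hpole h he hpos hAe hMe
  have hη := h.interpolant.mem_Icc
  obtain ⟨D, hD, s', hs', hDe⟩ := he.exists_polynomial hf
  have hss : s' * s' = 1 := by rcases hs' with rfl | rfl <;> norm_num
  -- Comparing `|U| |V|` at the points with its value `u` at `t` makes the bound proportional to
  -- `u`, which is divided out at the end. The constant thus does not depend on the normalization of
  -- `U`.
  set u := ‖linProd γ β t‖ * ‖linProd γ' β' t‖ with hu
  have hu0 : 0 < u := mul_pos (norm_pos_iff.2 (linProd_ne_zero he.im_ne he.ne_zero t))
    (norm_pos_iff.2 (linProd_ne_zero hf.im_ne hf.ne_zero t))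
  have hτ' : 0 ≤ τ * (M₁ * M' * u) := by positivity
  have hmain := abs_eval_le_of_alternating (N := N) (s := s * s') (D := D)
    (τ := τ * (M₁ * M' * u)) (σ := σ) h.interpolant.strictMono_points (by omega)
    (by rcases hs with rfl | rfl <;> rcases hs' with rfl | rfl <;> norm_num) hτ' hσ0 hη
    (h.separated he hω hc hAe hβc) (fun j => by
      rw [hDe _ (hη j)]
      have h1 := norm_linProd_le γ hc hβc (hη j) ht
      have h2 := hM' _ (hη j) t ht
      have h3 : ‖linProd γ β (η j)‖ * ‖linProd γ' β' (η j)‖ ≤ M₁ * M' * u := by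
        refine (mul_le_mul h1 h2 (norm_nonneg _) (by positivity)).trans (le_of_eq ?_)
        rw [hu]
        ring
      have h4 : 0 ≤ ‖linProd γ β (η j)‖ * ‖linProd γ' β' (η j)‖ := by positivity
      have h5 := halt j
      have h6 : s * s' * ((-1) ^ (j : ℕ) * (s' * (‖linProd γ β (η j)‖ * ‖linProd γ' β' (η j)‖
          * Real.sin ((e (η j) - f (η j)) / 2))))
          = (‖linProd γ β (η j)‖ * ‖linProd γ' β' (η j)‖) *
            (s * (-1) ^ (j : ℕ) * Real.sin ((e (η j) - f (η j)) / 2)) := by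
        linear_combination (‖linProd γ β (η j)‖ * ‖linProd γ' β' (η j)‖ *
            (s * (-1) ^ (j : ℕ) * Real.sin ((e (η j) - f (η j)) / 2))) * hss
      rw [h6]
      have h7 := mul_le_mul_of_nonneg_left h5 h4
      have h8 := mul_le_mul_of_nonneg_right h3 hτ
      linarith) ht
  rw [hDe t ht, abs_mul, abs_mul, ← hu, abs_of_pos hu0] at hmain
  have hs1 : |s'| = 1 := by rcases hs' with rfl | rfl <;> norm_num
  rw [hs1, one_mul, mul_comm] at hmain
  refine le_of_mul_le_mul_right (hmain.trans (le_of_eq ?_)) hu0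
  ring

lemma neg_le_sin_sub {a b α β τ : ℝ} (ha : α ≤ a) (hb : b ≤ β) (ha2 : a ≤ Real.pi / 2)
    (hb2 : -(Real.pi / 2) ≤ b) (hτ : |β - α| ≤ τ) : -τ ≤ Real.sin (a - b) := by
  have h1 := abs_le.1 hτ
  rcases le_or_gt 0 (a - b) with h | h
  · have := Real.sin_nonneg_of_nonneg_of_le_pi h (by linarith)
    linarith [abs_nonneg (β - α)]
  · have h2 := Real.sin_le (x := -(a - b)) (by linarith)
    rw [Real.sin_neg] at h2
    linarith

theorem tendsto_supNorm_sub {n : ℕ} {ω : ℝ} (hω : 0 < ω) {rBest : RatFunc ℂ}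
    (hBest : IsUnitaryBestApproximant n ω rBest) {r : ℕ → RatFunc ℂ}
    {x : ℕ → Fin (2 * n + 1) → ℝ} {η : ℕ → Fin (2 * n + 2) → ℝ}
    (h : ∀ k, IsAlternatingInterpolant n ω (r k) (x k) (η k))
    (hδ : Tendsto (fun k => errorInUniformity n ω (r k) (η k)) atTop (𝓝 0)) :
    Tendsto (fun k => supNorm (fun z => val (r k) z - val rBest z)) atTop (𝓝 0) := by
  set E := uniformError ω rBest with hE
  set δ := fun k => errorInUniformity n ω (r k) (η k) with hδdef
  have hlow : ∀ k, (1 - δ k) * uniformError ω (r k) ≤ E := fun k => ((h k).error_bounds hBest).1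
  have hup : ∀ k, E ≤ uniformError ω (r k) := fun k => ((h k).error_bounds hBest).2.1
  have hpe : ∀ k, ∀ t ∈ Set.Icc (-1 : ℝ) 1, pointError ω (r k) t ≤ uniformError ω (r k) :=
    fun k t ht => pointError_le_uniformError (h k).mem_unitaryClass.2 ω ht
  have hpb : ∀ t ∈ Set.Icc (-1 : ℝ) 1, pointError ω rBest t ≤ E :=
    fun t ht => pointError_le_uniformError hBest.1.2 ω ht
  have hE0 : 0 ≤ E := (pointError_nonneg ω rBest 0).trans (hpb 0 (by norm_num))
  have hE2 : E < 2 := (hup 0).trans_lt (h 0).nonmaximal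
  have hδ1 : Tendsto (fun k => 1 - δ k) atTop (𝓝 1) := by
    simpa using tendsto_const_nhds.sub hδ
  rcases hE0.eq_or_lt with hEz | hEpos
  -- If `E = 0`, then `(1 - δ k) * uniformError ω (r k) ≤ 0` forces zero error as soon as `δ k < 1`,
  -- so both functions agree with the exponential on the segment.
  · refine tendsto_const_nhds.congr' ?_
    filter_upwards [hδ1.eventually (lt_mem_nhds one_pos)] with k hk
    refine le_antisymm (supNorm_nonneg _) (supNorm_le fun t ht => ?_)
    have h1 := hlow k
    have h2 : uniformError ω (r k) ≤ 0 := by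
      rw [← hEz] at h1
      by_contra! hcon
      exact absurd h1 (not_le.2 (mul_pos hk hcon))
    have h3 : ‖val (r k) (Complex.I * t) - val rBest (Complex.I * t)‖
        ≤ pointError ω (r k) t + pointError ω rBest t := by
      unfold pointError
      rw [← norm_neg (val rBest _ - _), neg_sub]
      exact norm_sub_le_norm_sub_add_norm_sub _ _ _
    linarith [hpe k t ht, hpb t ht]
  obtain ⟨m', hm', γ', β', f, hf⟩ := exists_isPhaseRep (ω := ω) hBest.1
    fun t ht => (hpb t ht).trans_lt hE2
  -- `M` is the phase error belonging to the error `(2 + E) / 2`, midway between `E` and 2, which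
  -- eventually bounds the error of `r k`.
  set M := 2 * Real.arcsin ((2 + E) / 4) with hM
  have hMpi : M < Real.pi := by
    have := Real.arcsin_lt_pi_div_two.2 (show (2 + E) / 4 < 1 by linarith)
    linarith
  obtain ⟨C, hC⟩ := exists_abs_sin_le n hω (half_pos hEpos) hMpi hm' hf
  -- At the points, half the phase error of `r k` is at least `arcsin ((1 - δ k) E / 2)`, and half
  -- that of the best approximant is at most `arcsin (E / 2)` in modulus. The gap `τ k` bounds the
  -- defect of alternation.
  set τ : ℕ → ℝ := fun k => |Real.arcsin (E / 2) - Real.arcsin ((1 - δ k) * E / 2)| with hτ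
  have hτ0 : Tendsto τ atTop (𝓝 0) := by
    have h1 : Tendsto (fun k => Real.arcsin ((1 - δ k) * E / 2)) atTop (𝓝 (Real.arcsin (E / 2))) :=
      (Real.continuous_arcsin.tendsto _).comp (by simpa using (hδ1.mul_const E).div_const 2)
    simpa using ((tendsto_const_nhds (x := Real.arcsin (E / 2))).sub h1).abs
  have hev : ∀ᶠ k in atTop, supNorm (fun z => val (r k) z - val rBest z) ≤ 2 * (C * τ k) := by
    have hlim : Tendsto (fun k => (1 - δ k) * ((2 + E) / 2)) atTop (𝓝 ((2 + E) / 2)) := by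
      simpa using hδ1.mul_const ((2 + E) / 2)
    filter_upwards [hδ1.eventually (lt_mem_nhds (show (1 / 2 : ℝ) < 1 by norm_num)),
      hlim.eventually (lt_mem_nhds (show E < (2 + E) / 2 by linarith))] with k hk1 hk2
    have hk := h k
    have hη := hk.interpolant.mem_Icc
    have hEk : uniformError ω (r k) ≤ (2 + E) / 2 := by
      have := (hlow k).trans hk2.le
      exact le_of_mul_le_mul_left this (by linarith)
    have hεlow : ∀ j, (1 - δ k) * E ≤ pointError ω (r k) (η k j) := fun j =>
      (mul_le_mul_of_nonneg_left (hup k) (by linarith)).trans (hk.interpolant.one_sub_mul_le j)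
    have hεpos : ∀ j, 0 < pointError ω (r k) (η k j) := fun j =>
      (mul_pos (by linarith) hEpos).trans_le (hεlow j)
    obtain ⟨m, hm, γ, β, e, he⟩ := exists_isPhaseRep (ω := ω) hk.mem_unitaryClass
      fun t ht => (hpe k t ht).trans_lt hk.nonmaximal
    obtain ⟨s, hs, hse⟩ := he.exists_sign hη hk.alternates
    -- From `1 - δ k > 1 / 2` and `2 sin (|e| / 2) ≤ |e|`.
    have hAe : ∀ j, E / 2 ≤ |e (η k j)| := by
      intro j
      have h1 := he.pointError_eq (hη j)
      have h2 := Real.sin_le (x := |e (η k j)| / 2) (by positivity)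
      have h3 := hεlow j
      nlinarith
    have hMe : ∀ t ∈ Set.Icc (-1 : ℝ) 1, |e t| ≤ M := by
      intro t ht
      rw [he.abs_eq ht, hM]
      have := Real.monotone_arcsin (show pointError ω (r k) t / 2 ≤ (2 + E) / 4 by
        linarith [hpe k t ht])
      linarith
    have halt : ∀ j : Fin (2 * n + 2),
        -τ k ≤ s * (-1) ^ (j : ℕ) * Real.sin ((e (η k j) - f (η k j)) / 2) := by
      intro j
      have h1 : Real.arcsin ((1 - δ k) * E / 2) ≤ |e (η k j)| / 2 := by
        rw [he.abs_eq (hη j), mul_div_cancel_left₀ _ two_ne_zero]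
        exact Real.monotone_arcsin (by linarith [hεlow j])
      have h2 : |f (η k j)| / 2 ≤ Real.arcsin (E / 2) := by
        rw [hf.abs_eq (hη j), mul_div_cancel_left₀ _ two_ne_zero]
        exact Real.monotone_arcsin (by linarith [hpb _ (hη j)])
      have h3 := he.abs_lt_pi _ (hη j)
      have h4 := abs_lt.1 (hf.abs_lt_pi _ (hη j))
      have h5 := neg_abs_le (f (η k j))
      have h6 := le_abs_self (f (η k j))
      have hsj := hse j
      rw [← mul_assoc] at hsj
      have hcase : s * (-1) ^ (j : ℕ) = 1 ∨ s * (-1) ^ (j : ℕ) = -1 := by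
        rcases hs with rfl | rfl <;> rcases neg_one_pow_eq_or ℝ (j : ℕ) with h4 | h4 <;>
          simp [h4]
      rcases hcase with hc | hc
      · rw [hc, one_mul] at hsj ⊢
        have := neg_le_sin_sub (a := |e (η k j)| / 2) (b := f (η k j) / 2) h1
          (by linarith) (by linarith) (by linarith) (le_refl (τ k))
        rwa [← hsj, ← sub_div] at this
      · rw [hc] at hsj ⊢
        have := neg_le_sin_sub (a := |e (η k j)| / 2) (b := -f (η k j) / 2) h1
          (by linarith) (by linarith) (by linarith) (le_refl (τ k))
        rw [← hsj, ← sub_div] at this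
        rw [neg_one_mul, ← Real.sin_neg]
        convert this using 2
        ring
    have hfin := hC hk hm he hεpos hAe hMe hs (abs_nonneg _) halt
    refine supNorm_le fun t ht => ?_
    rw [he.norm_val_sub_eq hf ht]
    linarith [hfin t ht]
  refine squeeze_zero' (Eventually.of_forall fun k => supNorm_nonneg _) hev ?_
  simpa using (hτ0.const_mul C).const_mul 2

end UnitaryApprox

theorem mainTheorem1 (n : ℕ) (ω : ℝ) (hω : 0 < ω) (hωn : ω < (n + 1) * Real.pi)
    (rBest : RatFunc ℂ) (hBest : UnitaryApprox.IsUnitaryBestApproximant n ω rBest) :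
    (∀ (r : RatFunc ℂ) (x : Fin (2 * n + 1) → ℝ) (η : Fin (2 * n + 2) → ℝ),
      UnitaryApprox.IsAlternatingInterpolant n ω r x η →
        (1 - UnitaryApprox.errorInUniformity n ω r η) * UnitaryApprox.uniformError ω r
            ≤ UnitaryApprox.uniformError ω rBest ∧
        UnitaryApprox.uniformError ω rBest ≤ UnitaryApprox.uniformError ω r ∧
        |UnitaryApprox.uniformError ω r - UnitaryApprox.uniformError ω rBest|
            / UnitaryApprox.uniformError ω r
          ≤ UnitaryApprox.errorInUniformity n ω r η) ∧
    (∀ (r : ℕ → RatFunc ℂ) (x : ℕ → Fin (2 * n + 1) → ℝ) (η : ℕ → Fin (2 * n + 2) → ℝ),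
      (∀ k, UnitaryApprox.IsAlternatingInterpolant n ω (r k) (x k) (η k)) →
      Tendsto (fun k => UnitaryApprox.errorInUniformity n ω (r k) (η k)) atTop (𝓝 0) →
        Tendsto (fun k => UnitaryApprox.supNorm
          (fun z => UnitaryApprox.val (r k) z - UnitaryApprox.val rBest z)) atTop (𝓝 0)) :=
  ⟨fun _ _ _ h => h.error_bounds hBest,
    fun _ _ _ h hδ => UnitaryApprox.tendsto_supNorm_sub hω hBest h hδ⟩
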